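/- Let $\mathsf{HA}$ be intuitionistic first-order arithmetic with function symbols for all primitive recursive functions (successor axioms, defining equations of the primitive recursive functions, induction for all formulas), let $\mathsf{PA}=\mathsf{HA}+\mathrm{LEM}$, where $\mathrm{LEM}$ is the scheme $\varphi\lor\neg\varphi$ for all formulas, and let $\neg\varphi$ abbreviate $\varphi\to\bot$. A theory $T$ is given by axioms in the language of $\mathsf{HA}$ over intuitionistic predicate logic with equality (free variables in axioms are read as universally quantified). It is \emph{in-between} $\mathsf{HA}$ and $\mathsf{PA}$ if every theorem of $\mathsf{HA}$ is a theorem of $T$ and every theorem of $T$ is a theorem of $\mathsf{PA}$. Let $\mathrm{FV}(\varphi)$ be the set of free variables of $\varphi$. \emph{Prenex classes.} $\Sigma_0=\Pi_0$ is the class of quantifier-free formulas. $\Sigma_{k+1}$ is the class of formulas $\exists x_1\cdots\exists x_n\,\psi$ with $n\ge 1$ and $\psi\in\Pi_k$; $\Pi_{k+1}$ is the class of formulas $\forall x_1\cdots\forall x_n\,\psi$ with $n\ge 1$ and $\psi\in\Sigma_k$. \emph{The classes $\mathrm{E}_k$ and $\mathrm{U}_k$.} To each formula $\varphi$ a finite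 set $\mathrm{Alt}(\varphi)$ of finite sequences of signs $+,-$ is assigned. If $\varphi$ is quantifier-free, then $\mathrm{Alt}(\varphi)=\{\langle\,\rangle\}$. Otherwise, with $s^\perp$ denoting $s$ with all signs switched: $\mathrm{Alt}(\neg\varphi_1)=\{s^\perp: s\in\mathrm{Alt}(\varphi_1)\}$; $\mathrm{Alt}(\varphi_1\land\varphi_2)=\mathrm{Alt}(\varphi_1\lor\varphi_2)=\mathrm{Alt}(\varphi_1)\cup\mathrm{Alt}(\varphi_2)$; $\mathrm{Alt}(\varphi_1\to\varphi_2)=\{s^\perp: s\in\mathrm{Alt}(\varphi_1)\}\cup\mathrm{Alt}(\varphi_2)$ if $\varphi_2\not\equiv\bot$; $\mathrm{Alt}(\forall x\,\varphi_1)$ (resp. $\mathrm{Alt}(\exists x\,\varphi_1)$) is obtained from $\mathrm{Alt}(\varphi_1)$ by prefixing $-$ (resp. $+$) to every $s\in\mathrm{Alt}(\varphi_1)$ that does not already begin with $-$ (resp. $+$) and keeping the others. The degree of $\varphi$ is the maximal length of an element of $\mathrm{Alt}(\varphi)$. $\mathrm{E}_0=\mathrm{U}_0$ is the class of formulas of degree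 $0$; for $k\ge 1$, $\mathrm{E}_k$ (resp. $\mathrm{U}_k$) is the class of formulas $\varphi$ of degree $k$ such that every $s\in\mathrm{Alt}(\varphi)$ of length $k$ begins with $+$ (resp. $-$). \emph{Principles.} $\Sigma_k\text{-}\mathrm{DNE}$ is the scheme $\forall x(\neg\neg\varphi(x)\to\varphi(x))$ for $\varphi\in\Sigma_k$ with $\mathrm{FV}(\varphi)\subseteq\{x\}$. $(\Pi_k\lor\Pi_k)\text{-}\mathrm{DNE}$ is the scheme $\forall x(\neg\neg(\varphi(x)\lor\psi(x))\to\varphi(x)\lor\psi(x))$ for $\varphi,\psi\in\Pi_k$ with $\mathrm{FV}(\varphi)\cup\mathrm{FV}(\psi)\subseteq\{x\}$. A theory proves a scheme if it proves each of its instances. For classes $\Gamma,\Gamma'$ of formulas, $\mathrm{PNFT}_T(\Gamma,\Gamma')$ is the statement: for every $\varphi\in\Gamma$ there is $\varphi'\in\Gamma'$ with $\mathrm{FV}(\varphi)=\mathrm{FV}(\varphi')$ and $T\vdash\varphi\leftrightarrow\varphi'$. \textbf{Statement.} Let $T$ be a theory in-between $\mathsf{HA}$ and $\mathsf{PA}$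 and let $k$ be a natural number. Then $T$ proves both $\Sigma_k\text{-}\mathrm{DNE}$ and $(\Pi_k\lor\Pi_k)\text{-}\mathrm{DNE}$ if and only if, for all $k'\le k$, both $\mathrm{PNFT}_T(\mathrm{E}_{k'},\Sigma_{k'})$ and $\mathrm{PNFT}_T(\mathrm{U}_{k'},\Pi_{k'})$ hold. -/

import Mathlib

namespace SemiClassical

/-- Function symbols for the primitive recursive functions: one symbol of arity `n` for each
primitive recursive definition of an `n`-ary function. -/
inductive PRSymbol : ℕ → Type
  | zero : PRSymbol 0
  | succ : PRSymbol 1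
  | proj {n : ℕ} (i : Fin n) : PRSymbol n
  | comp {m n : ℕ} (f : PRSymbol m) (g : Fin m → PRSymbol n) : PRSymbol n
  | prec {n : ℕ} (f : PRSymbol n) (g : PRSymbol (n + 2)) : PRSymbol (n + 1)

/-- The language of arithmetic. Equality is a logical symbol, so there are no relation symbols. -/
abbrev arith : FirstOrder.Language.{0, 0} := ⟨PRSymbol, fun _ => Empty⟩

/-- Terms; the variables are indexed by natural numbers. -/
abbrev Tm : Type := arith.Term ℕ

/-- The term `f(t₁, …, tₙ)`. -/
def Tm.app {n : ℕ} (f : PRSymbol n) (t : Fin n → Tm) : Tm := FirstOrder.Language.Term.func f t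

/-- The term `0`. -/
def Tm.zero : Tm := Tm.app PRSymbol.zero Fin.elim0

/-- The term `S t`. -/
def Tm.succ (t : Tm) : Tm := Tm.app PRSymbol.succ (fun _ => t)

/-- Formulas of intuitionistic first-order arithmetic, up to renaming of bound variables
(de Bruijn indices): in `all φ` and `ex φ` the variable `0` of `φ` is bound, and the variable `n + 1`
of `φ` is the variable `n` of `all φ` and `ex φ`. -/
inductive Fml : Type
  | falsum : Fml
  | eq (s t : Tm) : Fml
  | and (φ ψ : Fml) : Fml
  | or (φ ψ : Fml) : Fml
  | imp (φ ψ : Fml) : Fml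
  | all (φ : Fml) : Fml
  | ex (φ : Fml) : Fml

namespace Fml

/-- `¬ φ` abbreviates `φ → ⊥`. -/
abbrev neg (φ : Fml) : Fml := imp φ falsum

/-- `φ ↔ ψ` abbreviates `(φ → ψ) ∧ (ψ → φ)`. -/
abbrev iff (φ ψ : Fml) : Fml := and (imp φ ψ) (imp ψ φ)

/-- The set of free variables of a formula. -/
def FV : Fml → Set ℕ
  | falsum => ∅
  | eq s t => ↑(s.varFinset ∪ t.varFinset)
  | and φ ψ => FV φ ∪ FV ψ
  | or φ ψ => FV φ ∪ FV ψ
  | imp φ ψ => FV φ ∪ FV ψ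
  | all φ => {n | n + 1 ∈ FV φ}
  | ex φ => {n | n + 1 ∈ FV φ}

/-- The substitution `σ` moved under a quantifier. -/
def up (σ : ℕ → Tm) : ℕ → Tm
  | 0 => FirstOrder.Language.Term.var 0
  | n + 1 => (σ n).relabel Nat.succ

/-- Simultaneous capture-avoiding substitution of `σ n` for the variable `n`, for all `n`. -/
def subst : Fml → (ℕ → Tm) → Fml
  | falsum, _ => falsum
  | eq s t, σ => eq (s.subst σ) (t.subst σ)
  | and φ ψ, σ => and (φ.subst σ) (ψ.subst σ)
  | or φ ψ, σ => or (φ.subst σ) (ψ.subst σ)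
  | imp φ ψ, σ => imp (φ.subst σ) (ψ.subst σ)
  | all φ, σ => all (φ.subst (up σ))
  | ex φ, σ => ex (φ.subst (up σ))

/-- `φ` in a context with one further variable, numbered `0`. -/
def shift (φ : Fml) : Fml := φ.subst (fun n => FirstOrder.Language.Term.var (n + 1))

/-- `φ(t)`, where `φ = φ(x)` is the matrix of a quantified formula, with bound variable `x = 0`. -/
def inst (φ : Fml) (t : Tm) : Fml :=
  φ.subst (fun n => Nat.casesOn n t (fun m => FirstOrder.Language.Term.var m))

/-- `φ(S x)`, where `x` is the variable `0`. -/
def stepSucc (φ : Fml) : Fml :=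
  φ.subst (fun n =>
    Nat.casesOn n (Tm.succ (FirstOrder.Language.Term.var 0)) (fun m => FirstOrder.Language.Term.var (m + 1)))

/-- Quantifier-free formulas. -/
def QF : Fml → Prop
  | falsum => True
  | eq _ _ => True
  | and φ ψ => QF φ ∧ QF ψ
  | or φ ψ => QF φ ∧ QF ψ
  | imp φ ψ => QF φ ∧ QF ψ
  | all _ => False
  | ex _ => False

end Fml

/-! ### Intuitionistic derivability -/

/-- `Derives T Γ φ`: in intuitionistic first-order logic with equality, `φ` is derivable from the
nonlogical axioms `T` and the open assumptions `Γ` (natural deduction). The eigenvariable conditions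
concern the assumptions `Γ` only, so an axiom with free variables has the force of its universal
closure. -/
inductive Derives (T : Set Fml) : List Fml → Fml → Prop
  | ax {Γ : List Fml} {φ : Fml} : φ ∈ T → Derives T Γ φ
  | hyp {Γ : List Fml} {φ : Fml} : φ ∈ Γ → Derives T Γ φ
  | falsumE {Γ : List Fml} {φ : Fml} : Derives T Γ Fml.falsum → Derives T Γ φ
  | andI {Γ : List Fml} {φ ψ : Fml} :
      Derives T Γ φ → Derives T Γ ψ → Derives T Γ (Fml.and φ ψ)
  | andE₁ {Γ : List Fml} {φ ψ : Fml} : Derives T Γ (Fml.and φ ψ) → Derives T Γ φ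
  | andE₂ {Γ : List Fml} {φ ψ : Fml} : Derives T Γ (Fml.and φ ψ) → Derives T Γ ψ
  | orI₁ {Γ : List Fml} {φ ψ : Fml} : Derives T Γ φ → Derives T Γ (Fml.or φ ψ)
  | orI₂ {Γ : List Fml} {φ ψ : Fml} : Derives T Γ ψ → Derives T Γ (Fml.or φ ψ)
  | orE {Γ : List Fml} {φ ψ χ : Fml} : Derives T Γ (Fml.or φ ψ) →
      Derives T (φ :: Γ) χ → Derives T (ψ :: Γ) χ → Derives T Γ χ
  | impI {Γ : List Fml} {φ ψ : Fml} : Derives T (φ :: Γ) ψ → Derives T Γ (Fml.imp φ ψ)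
  | impE {Γ : List Fml} {φ ψ : Fml} :
      Derives T Γ (Fml.imp φ ψ) → Derives T Γ φ → Derives T Γ ψ
  | allI {Γ : List Fml} {φ : Fml} :
      Derives T (Γ.map Fml.shift) φ → Derives T Γ (Fml.all φ)
  | allE {Γ : List Fml} {φ : Fml} (t : Tm) : Derives T Γ (Fml.all φ) → Derives T Γ (φ.inst t)
  | exI {Γ : List Fml} {φ : Fml} (t : Tm) : Derives T Γ (φ.inst t) → Derives T Γ (Fml.ex φ)
  | exE {Γ : List Fml} {φ χ : Fml} : Derives T Γ (Fml.ex φ) →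
      Derives T (φ :: Γ.map Fml.shift) χ.shift → Derives T Γ χ
  | eqRefl {Γ : List Fml} (t : Tm) : Derives T Γ (Fml.eq t t)
  | eqSubst {Γ : List Fml} {s t : Tm} (φ : Fml) : Derives T Γ (Fml.eq s t) →
      Derives T Γ (φ.inst s) → Derives T Γ (φ.inst t)

/-- `T ⊢ φ`, for a theory `T` given by its nonlogical axioms. -/
def Proves (T : Set Fml) (φ : Fml) : Prop := Derives T [] φ

/-- `T ⊢ P` for a schema `P`: every instance of `P` is provable in `T`. -/
def ProvesSchema (T P : Set Fml) : Prop := ∀ φ ∈ P, Proves T φ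

/-- Every theorem of `S` is a theorem of `T`. -/
def IsSubtheory (S T : Set Fml) : Prop := ∀ φ, Proves S φ → Proves T φ

/-! ### Intuitionistic and classical arithmetic -/

/-- The nonlogical axioms of Heyting arithmetic `HA`: the successor axioms, the defining equations
of the primitive recursive function symbols, and induction for all formulas. -/
inductive HA : Set Fml
  | succ_ne_zero (t : Tm) : HA (Fml.neg (Fml.eq (Tm.succ t) Tm.zero))
  | succ_inj (s t : Tm) : HA (Fml.imp (Fml.eq (Tm.succ s) (Tm.succ t)) (Fml.eq s t))
  | proj {n : ℕ} (i : Fin n) (t : Fin n → Tm) :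
      HA (Fml.eq (Tm.app (PRSymbol.proj i) t) (t i))
  | comp {m n : ℕ} (f : PRSymbol m) (g : Fin m → PRSymbol n) (t : Fin n → Tm) :
      HA (Fml.eq (Tm.app (PRSymbol.comp f g) t) (Tm.app f (fun i => Tm.app (g i) t)))
  | prec_zero {n : ℕ} (f : PRSymbol n) (g : PRSymbol (n + 2)) (t : Fin n → Tm) :
      HA (Fml.eq (Tm.app (PRSymbol.prec f g) (Fin.cons Tm.zero t)) (Tm.app f t))
  | prec_succ {n : ℕ} (f : PRSymbol n) (g : PRSymbol (n + 2)) (s : Tm) (t : Fin n → Tm) :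
      HA (Fml.eq (Tm.app (PRSymbol.prec f g) (Fin.cons (Tm.succ s) t))
        (Tm.app g (Fin.cons s (Fin.cons (Tm.app (PRSymbol.prec f g) (Fin.cons s t)) t))))
  | induction (φ : Fml) :
      HA (Fml.imp (Fml.and (φ.inst Tm.zero) (Fml.all (Fml.imp φ φ.stepSucc))) (Fml.all φ))

/-- The law of excluded middle for all formulas. -/
def LEM : Set Fml := {χ | ∃ φ : Fml, χ = Fml.or φ (Fml.neg φ)}

/-- Peano arithmetic, `PA = HA + LEM`. -/
def PA : Set Fml := HA ∪ LEM

/-! ### The classes `Σ_k` and `Π_k` -/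

mutual

/-- `Σ_k`: `k` alternating blocks of quantifiers, the first one existential, each block non-empty,
in front of a quantifier-free formula. -/
def SigmaClass : ℕ → Set Fml
  | 0 => {φ | φ.QF}
  | k + 1 => {φ | ∃ n : ℕ, 0 < n ∧ ∃ ψ ∈ PiClass k, φ = Fml.ex^[n] ψ}

/-- `Π_k`: `k` alternating blocks of quantifiers, the first one universal, each block non-empty,
in front of a quantifier-free formula. -/
def PiClass : ℕ → Set Fml
  | 0 => {φ | φ.QF}
  | k + 1 => {φ | ∃ n : ℕ, 0 < n ∧ ∃ ψ ∈ SigmaClass k, φ = Fml.all^[n] ψ}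

end

/-! ### Double negation elimination -/

/-- `Γ-DNE`: the sentences `∀ x (¬¬φ(x) → φ(x))`, where `φ ∈ Γ` and `FV(φ) ⊆ {x}`. -/
def DNE (Γ : Set Fml) : Set Fml :=
  {χ | ∃ φ ∈ Γ, φ.FV ⊆ {0} ∧ χ = Fml.all (Fml.imp (Fml.neg (Fml.neg φ)) φ)}

/-- `(Γ ∨ Γ')-DNE`: the sentences `∀ x (¬¬(φ(x) ∨ ψ(x)) → φ(x) ∨ ψ(x))`, where `φ ∈ Γ`, `ψ ∈ Γ'`,
and `FV(φ), FV(ψ) ⊆ {x}`. -/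
def DNEOr (Γ Γ' : Set Fml) : Set Fml :=
  {χ | ∃ φ ∈ Γ, ∃ ψ ∈ Γ', φ.FV ⊆ {0} ∧ ψ.FV ⊆ {0} ∧
    χ = Fml.all (Fml.imp (Fml.neg (Fml.neg (Fml.or φ ψ))) (Fml.or φ ψ))}

/-! ### Alternation paths and the classes `E_k` and `U_k` -/

/-- `s^⊥`: all signs of a path are switched. Paths are lists of signs, with `true` for `+` and
`false` for `-`. -/
def perp (s : List Bool) : List Bool := s.map Bool.not

/-- The path `s` if its first sign is `b`, and `b s` (with `b` put in front) otherwise. -/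
def extend (b : Bool) (s : List Bool) : List Bool := if s.head? = some b then s else b :: s

/-- The set of alternation paths of a formula. -/
def Alt : Fml → Finset (List Bool)
  | .falsum => {[]}
  | .eq _ _ => {[]}
  | .and φ ψ => Alt φ ∪ Alt ψ
  | .or φ ψ => Alt φ ∪ Alt ψ
  | .imp φ .falsum => (Alt φ).image perp
  | .imp φ ψ => (Alt φ).image perp ∪ Alt ψ
  | .all φ => (Alt φ).image (extend false)
  | .ex φ => (Alt φ).image (extend true)

/-- The clauses for the connectives agree with the stipulation that the empty path is the only path
of a quantifier-free formula. -/
theorem Alt_of_QF : ∀ φ : Fml, φ.QF → Alt φ = {[]}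
  | .falsum, _ => by simp [Alt]
  | .eq _ _, _ => by simp [Alt]
  | .and φ ψ, h => by simp [Alt, Alt_of_QF φ h.1, Alt_of_QF ψ h.2]
  | .or φ ψ, h => by simp [Alt, Alt_of_QF φ h.1, Alt_of_QF ψ h.2]
  | .imp φ ψ, h => by
    have h₁ := Alt_of_QF φ h.1
    have h₂ := Alt_of_QF ψ h.2
    cases ψ <;> simp only [Alt, h₁] at h₂ ⊢ <;> simp [h₂, perp]

/-- The degree of a formula: the maximal length of its alternation paths. -/
def degree (φ : Fml) : ℕ := (Alt φ).sup List.length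

/-- `F_k`: the formulas of degree `k`. -/
def FClass (k : ℕ) : Set Fml := {φ | degree φ = k}

/-- `U_k`: for `k > 0`, the formulas of degree `k` all of whose alternation paths of length `k`
begin with `-`. -/
def UClass : ℕ → Set Fml
  | 0 => FClass 0
  | k + 1 => {φ | φ ∈ FClass (k + 1) ∧
      ∀ s ∈ Alt φ, s.length = k + 1 → s.head? = some false}

/-- `E_k`: for `k > 0`, the formulas of degree `k` all of whose alternation paths of length `k`
begin with `+`. -/
def EClass : ℕ → Set Fml
  | 0 => FClass 0
  | k + 1 => {φ | φ ∈ FClass (k + 1) ∧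
      ∀ s ∈ Alt φ, s.length = k + 1 → s.head? = some true}

/-! ### Prenex normal form theorems -/

/-- The prenex normal form theorem for `Γ` and `Γ'` in `T`: every formula in `Γ` is provably
equivalent in `T` to a formula in `Γ'` with the same free variables. -/
def PNFT (T Γ Γ' : Set Fml) : Prop :=
  ∀ φ ∈ Γ, ∃ φ' ∈ Γ', φ.FV = φ'.FV ∧ Proves T (Fml.iff φ φ')

end SemiClassical

namespace SemiClassical

open FirstOrder.Language (Term)

/-! ### Substitution -/

-- Both directions pass through `StableClasses`, that is, `Σ_k`-DNE and `(Π_k ∨ Π_k)`-DNE with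
-- arbitrary parameters. The schemes with one parameter suffice for it, because finitely many values
-- can be coded by one number (`exists_code`, `stable_of_coded`).
--
-- From the principles to normal forms, the argument is an induction on the formula
-- (`prenex_of_altBound`). Since `E_k` and `U_k` demand the exact degree `k`, they do not pass to
-- subformulas, and the induction runs over the cumulative condition `AltBound`. Most quantifier
-- shifts are intuitionistically valid. The exceptions are paid for by the principles: `¬∀xφ → ∃x¬φ`
-- and the passage from `φ → ψ` to `¬φ ∨ ψ`, with `φ` in `Π_k` and `ψ` in `Σ_k`, use `Σ_k`-DNE;
-- pulling `∀` out of a disjunction of `Π_k` formulas also uses `(Π_k ∨ Π_k)`-DNE (`Eqv.all_or`).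
--
-- For the converse, `T` must be shown to prove certain consequences of `PA`. The tool is the
-- negative translation `tr φ A` with an arbitrary formula `A` in place of `⊥`, which interprets
-- `PA` in `T` (`tr_sound`). If `T` proves excluded middle for `Σ_j`, then the translation of a
-- `Σ_j` or `Π_j` formula `φ` amounts to `φ ∨ A`. For `Σ_{j+1}` formulas one still has that `tr φ A`
-- and `φ → A` together yield `A`, and a suitable choice of `A` makes `PA` conservative over `T` for
-- `Σ_{j+1}` formulas, implications between them, and `Π_{j+2}` formulas.
--
-- Excluded middle then climbs the hierarchy. For `φ` in `Σ_{j+1}`, the formula `∀x(φ ∨ ¬φ)` is in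
-- `U_{j+2}`, so it has a `Π_{j+2}` normal form, which is a theorem of `PA` and hence of `T`
-- (`decides_sigma_of_PNFT`). At the top level, `¬¬φ` with `φ` in `Σ_k` has a `Σ_k` normal form,
-- which implies `φ` in `PA` and hence in `T`. Finally, a disjunction of `Π_k` formulas has a `Π_k`
-- normal form, and `Π_k` formulas are stable by `Σ_k`-DNE (`stableClasses_of_PNFT`).

theorem Tm.subst_subst (t : Tm) (σ τ : ℕ → Tm) :
    (t.subst σ).subst τ = t.subst (fun n => (σ n).subst τ) := by
  induction t with
  | var n => rfl
  | func f ts ih => simp only [Term.subst, ih]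

theorem Tm.subst_var (t : Tm) : t.subst Term.var = t := by
  induction t with
  | var n => rfl
  | func f ts ih => simp only [Term.subst, ih]

theorem Tm.relabel_eq_subst (t : Tm) (f : ℕ → ℕ) :
    t.relabel f = t.subst (fun n => Term.var (f n)) := by
  induction t with
  | var n => rfl
  | func f ts ih => simp only [Term.relabel, Term.subst, ih]

theorem Tm.subst_congr (t : Tm) {σ τ : ℕ → Tm} (h : ∀ n ∈ t.varFinset, σ n = τ n) :
    t.subst σ = t.subst τ := by
  induction t with
  | var n => exact h n (by simp [Term.varFinset])
  | func f ts ih =>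
    simp only [Term.subst, Term.func.injEq, heq_eq_eq, true_and]
    funext i
    exact ih i fun n hn => h n (by
      simp only [Term.varFinset, Finset.mem_biUnion, Finset.mem_univ, true_and]
      exact ⟨i, hn⟩)

theorem Tm.mem_varFinset_subst (t : Tm) (σ : ℕ → Tm) (m : ℕ) :
    m ∈ (t.subst σ).varFinset ↔ ∃ n ∈ t.varFinset, m ∈ (σ n).varFinset := by
  induction t with
  | var n => simp [Term.subst, Term.varFinset]
  | func f ts ih =>
    simp only [Term.subst, Term.varFinset, Finset.mem_biUnion, Finset.mem_univ, true_and, ih]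
    exact ⟨fun ⟨i, n, hn, hm⟩ => ⟨n, ⟨i, hn⟩, hm⟩, fun ⟨n, ⟨i, hn⟩, hm⟩ => ⟨i, n, hn, hm⟩⟩

/-- The substitution of `t` for the variable `0` and of `σ n` for the variable `n + 1`. -/
def scons (t : Tm) (σ : ℕ → Tm) (n : ℕ) : Tm := Nat.casesOn n t σ

@[simp] theorem scons_zero (t : Tm) (σ : ℕ → Tm) : scons t σ 0 = t := rfl

@[simp] theorem scons_succ (t : Tm) (σ : ℕ → Tm) (n : ℕ) : scons t σ (n + 1) = σ n := rfl

/-- The term `t` in a context with one further variable. -/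
def Tm.shift (t : Tm) : Tm := t.subst (fun n => Term.var (n + 1))

@[simp] theorem Tm.shift_subst_scons (t s : Tm) (σ : ℕ → Tm) :
    t.shift.subst (scons s σ) = t.subst σ := Tm.subst_subst ..

namespace Fml

@[simp] theorem up_zero (σ : ℕ → Tm) : up σ 0 = Term.var 0 := rfl

@[simp] theorem up_succ (σ : ℕ → Tm) (n : ℕ) : up σ (n + 1) = (σ n).shift :=
  Tm.relabel_eq_subst _ _

theorem up_subst (σ τ : ℕ → Tm) :
    (fun n => (up σ n).subst (up τ)) = up (fun n => (σ n).subst τ) := by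
  funext n
  cases n with
  | zero => rfl
  | succ n =>
    simp only [up_succ, Tm.shift, Tm.subst_subst]
    simp only [Term.subst, up_succ, Tm.shift]

theorem up_var : up Term.var = Term.var := by
  funext n; cases n <;> rfl

theorem subst_subst (φ : Fml) : ∀ σ τ : ℕ → Tm,
    (φ.subst σ).subst τ = φ.subst (fun n => (σ n).subst τ) := by
  induction φ with
  | falsum => intros; rfl
  | eq s t => intros; simp only [subst, Tm.subst_subst]
  | and φ ψ h₁ h₂ => intros; simp only [subst, h₁, h₂]
  | or φ ψ h₁ h₂ => intros; simp only [subst, h₁, h₂]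
  | imp φ ψ h₁ h₂ => intros; simp only [subst, h₁, h₂]
  | all φ h => intros; simp only [subst, h, up_subst]
  | ex φ h => intros; simp only [subst, h, up_subst]

theorem subst_var (φ : Fml) : φ.subst Term.var = φ := by
  induction φ with
  | falsum => rfl
  | eq s t => simp only [subst, Tm.subst_var]
  | and φ ψ h₁ h₂ => simp only [subst, h₁, h₂]
  | or φ ψ h₁ h₂ => simp only [subst, h₁, h₂]
  | imp φ ψ h₁ h₂ => simp only [subst, h₁, h₂]
  | all φ h => simp only [subst, up_var, h]
  | ex φ h => simp only [subst, up_var, h]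

theorem subst_congr (φ : Fml) : ∀ {σ τ : ℕ → Tm}, (∀ n ∈ φ.FV, σ n = τ n) →
    φ.subst σ = φ.subst τ := by
  have key : ∀ (φ : Fml) (σ τ : ℕ → Tm), (∀ n ∈ {n | n + 1 ∈ φ.FV}, σ n = τ n) →
      ∀ n ∈ φ.FV, up σ n = up τ n := by
    intro φ σ τ h n hn
    cases n with
    | zero => rfl
    | succ n => rw [up_succ, up_succ, h n hn]
  induction φ with
  | falsum => intros; rfl
  | eq s t =>
    intro σ τ h
    simp only [subst]
    rw [Tm.subst_congr s fun n hn => h n (by simp [FV, hn]),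
      Tm.subst_congr t fun n hn => h n (by simp [FV, hn])]
  | and φ ψ h₁ h₂ | or φ ψ h₁ h₂ | imp φ ψ h₁ h₂ =>
    intro σ τ h
    simp only [subst]
    rw [h₁ fun n hn => h n (Or.inl hn), h₂ fun n hn => h n (Or.inr hn)]
  | all φ ih | ex φ ih =>
    intro σ τ h
    simp only [subst]
    rw [ih (key φ σ τ h)]

theorem mem_FV_subst (φ : Fml) : ∀ (σ : ℕ → Tm) (m : ℕ),
    m ∈ (φ.subst σ).FV ↔ ∃ n ∈ φ.FV, m ∈ (σ n).varFinset := by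
  have key : ∀ (φ : Fml) (σ : ℕ → Tm) (m : ℕ),
      (∃ n ∈ φ.FV, m + 1 ∈ (up σ n).varFinset) ↔ ∃ n, n + 1 ∈ φ.FV ∧ m ∈ (σ n).varFinset := by
    have hsh : ∀ (t : Tm) (m : ℕ), m + 1 ∈ t.shift.varFinset ↔ m ∈ t.varFinset := by
      intro t m
      simp [Tm.shift, Tm.mem_varFinset_subst, Term.varFinset]
    intro φ σ m
    constructor
    · rintro ⟨n, hn, hm⟩
      cases n with
      | zero => simp [Term.varFinset] at hm
      | succ n => exact ⟨n, hn, by simpa [hsh] using hm⟩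
    · rintro ⟨n, hn, hm⟩
      exact ⟨n + 1, hn, by simpa [hsh] using hm⟩
  induction φ with
  | falsum => intro σ m; simp [FV, subst]
  | eq s t =>
    intro σ m
    simp only [FV, subst, Finset.coe_union, Set.mem_union, Finset.mem_coe,
      Tm.mem_varFinset_subst, or_and_right, exists_or]
  | and φ ψ h₁ h₂ | or φ ψ h₁ h₂ | imp φ ψ h₁ h₂ =>
    intro σ m
    simp only [FV, subst, Set.mem_union, h₁, h₂, or_and_right, exists_or]
  | all φ ih | ex φ ih =>
    intro σ m
    simp only [FV, subst, Set.mem_ofPred_eq, ih, key]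

@[simp] theorem succ_mem_FV_shift (φ : Fml) (m : ℕ) : m + 1 ∈ φ.shift.FV ↔ m ∈ φ.FV := by
  simp [shift, mem_FV_subst, Term.varFinset]

theorem exists_FV_lt (φ : Fml) : ∃ N, ∀ n ∈ φ.FV, n < N := by
  induction φ with
  | falsum => exact ⟨0, by simp [FV]⟩
  | eq s t =>
    refine ⟨(s.varFinset ∪ t.varFinset).sup id + 1, fun n hn => Nat.lt_succ_of_le ?_⟩
    exact Finset.le_sup (f := id) (by simpa only [FV, Finset.mem_coe] using hn)
  | and φ ψ h₁ h₂ | or φ ψ h₁ h₂ | imp φ ψ h₁ h₂ =>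
    obtain ⟨N₁, h₁⟩ := h₁
    obtain ⟨N₂, h₂⟩ := h₂
    refine ⟨max N₁ N₂, fun n hn => ?_⟩
    rcases hn with hn | hn
    · exact lt_max_of_lt_left (h₁ n hn)
    · exact lt_max_of_lt_right (h₂ n hn)
  | all φ ih | ex φ ih =>
    obtain ⟨N, h⟩ := ih
    exact ⟨N, fun n hn => (Nat.lt_succ_self n).trans (h _ hn)⟩

theorem inst_eq (φ : Fml) (t : Tm) : φ.inst t = φ.subst (scons t Term.var) := rfl

theorem subst_up_inst (φ : Fml) (σ : ℕ → Tm) (t : Tm) :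
    (φ.subst (up σ)).inst t = φ.subst (scons t σ) := by
  rw [inst_eq, subst_subst]
  congr 1; funext n
  cases n with
  | zero => rfl
  | succ n => rw [up_succ, Tm.shift_subst_scons, Tm.subst_var, scons_succ]

theorem inst_subst (φ : Fml) (t : Tm) (σ : ℕ → Tm) :
    (φ.inst t).subst σ = φ.subst (scons (t.subst σ) σ) := by
  rw [inst_eq, subst_subst]
  congr 1; funext n
  cases n <;> rfl

theorem inst_subst' (φ : Fml) (t : Tm) (σ : ℕ → Tm) :
    (φ.inst t).subst σ = (φ.subst (up σ)).inst (t.subst σ) := by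
  rw [inst_subst, subst_up_inst]

theorem shift_subst_scons (φ : Fml) (t : Tm) (σ : ℕ → Tm) :
    φ.shift.subst (scons t σ) = φ.subst σ := by
  rw [shift, subst_subst]; rfl

@[simp] theorem shift_inst (φ : Fml) (t : Tm) : φ.shift.inst t = φ := by
  rw [inst_eq, shift_subst_scons, subst_var]

theorem shift_subst_up (φ : Fml) (σ : ℕ → Tm) :
    φ.shift.subst (up σ) = (φ.subst σ).shift := by
  rw [shift, shift, subst_subst, subst_subst]
  congr 1; funext n
  simp only [Term.subst, up_succ, Tm.shift]

theorem stepSucc_eq (φ : Fml) : φ.stepSucc =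
    φ.subst (scons (Tm.succ (Term.var 0)) (fun n => Term.var (n + 1))) := rfl

theorem stepSucc_inst (φ : Fml) (t : Tm) : φ.stepSucc.inst t = φ.inst t.succ := by
  rw [inst_eq, stepSucc_eq, subst_subst, inst_eq]
  congr 1; funext n
  cases n <;> rfl

end Fml

/-! ### Structural rules -/

namespace Derives

variable {T : Set Fml} {Γ Δ : List Fml} {φ ψ χ : Fml}

theorem mono (h : Derives T Γ φ) : ∀ {Δ : List Fml}, Γ ⊆ Δ → Derives T Δ φ := by
  induction h with
  | ax h => exact fun _ => ax h
  | hyp h => exact fun hΔ => hyp (hΔ h)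
  | falsumE _ ih => exact fun hΔ => falsumE (ih hΔ)
  | andI _ _ ih₁ ih₂ => exact fun hΔ => andI (ih₁ hΔ) (ih₂ hΔ)
  | andE₁ _ ih => exact fun hΔ => andE₁ (ih hΔ)
  | andE₂ _ ih => exact fun hΔ => andE₂ (ih hΔ)
  | orI₁ _ ih => exact fun hΔ => orI₁ (ih hΔ)
  | orI₂ _ ih => exact fun hΔ => orI₂ (ih hΔ)
  | orE _ _ _ ih ih₁ ih₂ =>
    exact fun hΔ => orE (ih hΔ) (ih₁ (List.cons_subset_cons _ hΔ)) (ih₂ (List.cons_subset_cons _ hΔ))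
  | impI _ ih => exact fun hΔ => impI (ih (List.cons_subset_cons _ hΔ))
  | impE _ _ ih₁ ih₂ => exact fun hΔ => impE (ih₁ hΔ) (ih₂ hΔ)
  | allI _ ih => exact fun hΔ => allI (ih (List.map_subset _ hΔ))
  | allE t _ ih => exact fun hΔ => allE t (ih hΔ)
  | exI t _ ih => exact fun hΔ => exI t (ih hΔ)
  | exE _ _ ih₁ ih₂ =>
    exact fun hΔ => exE (ih₁ hΔ) (ih₂ (List.cons_subset_cons _ (List.map_subset _ hΔ)))
  | eqRefl t => exact fun _ => eqRefl t
  | eqSubst φ _ _ ih₁ ih₂ => exact fun hΔ => eqSubst φ (ih₁ hΔ) (ih₂ hΔ)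

theorem of_proves (h : Proves T φ) : Derives T Γ φ := h.mono (List.nil_subset _)

/-- Derivations can be transformed by a substitution if the axioms can. -/
theorem subst_of_axioms {S : Set Fml} (hS : ∀ φ ∈ S, ∀ σ, Proves T (φ.subst σ))
    (h : Derives S Γ φ) : ∀ σ : ℕ → Tm, Derives T (Γ.map fun γ => γ.subst σ) (φ.subst σ) := by
  have hshift : ∀ (Γ : List Fml) (σ : ℕ → Tm), (Γ.map Fml.shift).map (fun γ => γ.subst (Fml.up σ)) =
      (Γ.map fun γ => γ.subst σ).map Fml.shift := by
    intro Γ σ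
    simp only [List.map_map]
    exact List.map_congr_left fun γ _ => Fml.shift_subst_up γ σ
  induction h with
  | ax h => exact fun σ => of_proves (hS _ h σ)
  | hyp h => exact fun σ => hyp (List.mem_map_of_mem h)
  | falsumE _ ih => exact fun σ => falsumE (ih σ)
  | andI _ _ ih₁ ih₂ => exact fun σ => andI (ih₁ σ) (ih₂ σ)
  | andE₁ _ ih => exact fun σ => andE₁ (ih σ)
  | andE₂ _ ih => exact fun σ => andE₂ (ih σ)
  | orI₁ _ ih => exact fun σ => orI₁ (ih σ)
  | orI₂ _ ih => exact fun σ => orI₂ (ih σ)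
  | orE _ _ _ ih ih₁ ih₂ => exact fun σ => orE (ih σ) (ih₁ σ) (ih₂ σ)
  | impI _ ih => exact fun σ => impI (ih σ)
  | impE _ _ ih₁ ih₂ => exact fun σ => impE (ih₁ σ) (ih₂ σ)
  | allI _ ih => exact fun σ => allI (by simpa only [hshift] using ih (Fml.up σ))
  | allE t _ ih => exact fun σ => by rw [Fml.inst_subst']; exact allE _ (ih σ)
  | exI t _ ih =>
    exact fun σ => exI (t.subst σ) (by rw [← Fml.inst_subst']; exact ih σ)
  | exE _ _ ih₁ ih₂ =>
    refine fun σ => exE (ih₁ σ) ?_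
    have h := ih₂ (Fml.up σ)
    rwa [List.map_cons, hshift, Fml.shift_subst_up] at h
  | eqRefl t => exact fun σ => eqRefl _
  | eqSubst φ _ _ ih₁ ih₂ =>
    intro σ
    have h₂ := ih₂ σ
    rw [Fml.inst_subst'] at h₂ ⊢
    exact eqSubst _ (ih₁ σ) h₂

theorem proves_all_iterate (h : Proves T φ) (n : ℕ) : Proves T (Fml.all^[n] φ) := by
  induction n with
  | zero => exact h
  | succ n ih => rw [Function.iterate_succ_apply']; exact allI ih

theorem FV_all_iterate (φ : Fml) (n m : ℕ) : m ∈ (Fml.all^[n] φ).FV ↔ m + n ∈ φ.FV := by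
  induction n generalizing m with
  | zero => rfl
  | succ n ih =>
    rw [Function.iterate_succ_apply']
    exact (ih (m + 1)).trans (by rw [Nat.add_right_comm, Nat.add_assoc])

/-- An axiom with free variables has the force of its universal closure. -/
theorem proves_subst (h : Proves T φ) (σ : ℕ → Tm) : Proves T (φ.subst σ) := by
  have key : ∀ (n : ℕ) (φ : Fml) (σ : ℕ → Tm),
      Proves T ((Fml.all^[n] φ).subst fun m => σ (m + n)) → Proves T (φ.subst σ) := by
    intro n
    induction n with
    | zero => exact fun φ σ h => h
    | succ n ih =>
      intro φ σ h
      have h' := allE (σ 0) (ih (Fml.all φ) (fun m => σ (m + 1)) h)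
      rw [Fml.subst_up_inst] at h'
      rwa [show scons (σ 0) (fun m => σ (m + 1)) = σ from funext fun m => by cases m <;> rfl] at h'
  obtain ⟨N, hN⟩ := Fml.exists_FV_lt φ
  -- With `N` beyond all free variables of `φ`, the formula `Fml.all^[N] φ` is closed, so the
  -- substitution demanded by `key` leaves it unchanged.
  apply key N
  rw [Fml.subst_congr (τ := Term.var), Fml.subst_var]
  · exact proves_all_iterate h N
  · intro m hm
    have := hN _ ((FV_all_iterate φ N m).1 hm)
    omega

theorem subst (h : Derives T Γ φ) (σ : ℕ → Tm) :
    Derives T (Γ.map fun γ => γ.subst σ) (φ.subst σ) :=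
  subst_of_axioms (fun _ hφ σ => proves_subst (ax hφ) σ) h σ

/-! ### Rules in the style of forcing -/

/-- Quantifying over all larger contexts lets derivations be handled like truth at the nodes of a
Kripke model: assumptions become Lean hypotheses, transported by `mono`. -/
theorem imp_intro (h : ∀ Δ, Γ ⊆ Δ → Derives T Δ φ → Derives T Δ ψ) : Derives T Γ (Fml.imp φ ψ) :=
  impI (h _ (List.subset_cons_self _ _) (hyp List.mem_cons_self))

theorem or_elim (h : Derives T Γ (Fml.or φ ψ))
    (h₁ : ∀ Δ, Γ ⊆ Δ → Derives T Δ φ → Derives T Δ χ)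
    (h₂ : ∀ Δ, Γ ⊆ Δ → Derives T Δ ψ → Derives T Δ χ) : Derives T Γ χ :=
  orE h (h₁ _ (List.subset_cons_self _ _) (hyp List.mem_cons_self))
    (h₂ _ (List.subset_cons_self _ _) (hyp List.mem_cons_self))

theorem exists_fresh (Γ : List Fml) : ∃ N, ∀ γ ∈ Γ, ∀ n ∈ γ.FV, n < N := by
  induction Γ with
  | nil => exact ⟨0, by simp⟩
  | cons γ Γ ih =>
    obtain ⟨N₁, h₁⟩ := ih
    obtain ⟨N₂, h₂⟩ := γ.exists_FV_lt
    refine ⟨max N₁ N₂, fun δ hδ n hn => ?_⟩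
    rcases List.mem_cons.1 hδ with rfl | hδ
    · exact lt_max_of_lt_right (h₂ n hn)
    · exact lt_max_of_lt_left (h₁ δ hδ n hn)

/-- The substitution that turns the fresh variable `N` into the variable `0`. -/
def bindVar (N n : ℕ) : Tm := if n = N then Term.var 0 else Term.var (n + 1)

theorem subst_bindVar {N : ℕ} (hN : ∀ n ∈ φ.FV, n < N) : φ.subst (bindVar N) = φ.shift :=
  Fml.subst_congr φ fun n hn => if_neg (hN n hn).ne

theorem inst_subst_bindVar {N : ℕ} (hN : ∀ n ∈ φ.FV, n < N) :
    (φ.inst (Term.var N)).subst (bindVar N) = φ := by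
  rw [Fml.inst_subst]
  refine (Fml.subst_congr φ fun n hn => ?_).trans (Fml.subst_var φ)
  cases n with
  | zero => simp [Term.subst, bindVar]
  | succ n =>
    have := hN _ hn
    exact if_neg (by omega)

theorem all_intro (h : ∀ t, Derives T Γ (φ.inst t)) : Derives T Γ (Fml.all φ) := by
  obtain ⟨N, hN⟩ := exists_fresh (φ :: Γ)
  -- The fresh variable `N` serves as eigenvariable. Renaming it to `0` and moving the other
  -- variables up by one gives the premise of `allI`.
  have h' := (h (Term.var N)).subst (bindVar N)
  rw [inst_subst_bindVar (hN φ List.mem_cons_self)] at h'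
  rw [List.map_congr_left fun γ hγ => subst_bindVar (hN γ (List.mem_cons_of_mem _ hγ))] at h'
  exact allI h'

theorem ex_elim (h : Derives T Γ (Fml.ex φ))
    (h₁ : ∀ Δ t, Γ ⊆ Δ → Derives T Δ (φ.inst t) → Derives T Δ χ) : Derives T Γ χ := by
  obtain ⟨N, hN⟩ := exists_fresh (χ :: φ :: Γ)
  have h' := (h₁ (φ.inst (Term.var N) :: Γ) (Term.var N) (List.subset_cons_self _ _)
    (hyp List.mem_cons_self)).subst (bindVar N)
  rw [List.map_cons, inst_subst_bindVar (hN φ (by simp)), subst_bindVar (hN χ (by simp)),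
    List.map_congr_left fun γ hγ => subst_bindVar (hN γ (by simp [hγ]))] at h'
  exact exE h h'

/-! ### Equality -/

theorem eq_symm {s t : Tm} (h : Derives T Γ (Fml.eq s t)) : Derives T Γ (Fml.eq t s) := by
  have h' := eqSubst (Fml.eq (Term.var 0) s.shift) h
    (by simpa [Fml.inst_eq, Fml.subst, Term.subst, Tm.subst_var] using eqRefl s)
  simpa [Fml.inst_eq, Fml.subst, Term.subst, Tm.subst_var] using h'

theorem eq_trans {s t u : Tm} (h₁ : Derives T Γ (Fml.eq s t)) (h₂ : Derives T Γ (Fml.eq t u)) :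
    Derives T Γ (Fml.eq s u) := by
  have h' := eqSubst (Fml.eq s.shift (Term.var 0)) h₂
    (by simpa [Fml.inst_eq, Fml.subst, Term.subst, Tm.subst_var] using h₁)
  simpa [Fml.inst_eq, Fml.subst, Term.subst, Tm.subst_var] using h'

/-- Simultaneous replacement of equals by equals. -/
theorem subst_eq {σ τ : ℕ → Tm} (h : ∀ n ∈ φ.FV, Derives T Γ (Fml.eq (σ n) (τ n)))
    (hφ : Derives T Γ (φ.subst σ)) : Derives T Γ (φ.subst τ) := by
  -- The replacement proceeds one variable at a time; after `k` stages the variables below `k` have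
  -- their new values.
  have key : ∀ k : ℕ, Derives T Γ (φ.subst fun n => if n < k then τ n else σ n) := by
    intro k
    induction k with
    | zero => simpa using hφ
    | succ k ih =>
      by_cases hk : k ∈ φ.FV
      -- In `ψ` the place of variable `k` is left open as the new variable `0`, and all other values
      -- are shifted past it, so that `eqSubst` applies.
      · let ψ := φ.subst fun n => if n = k then Term.var 0 else
          Tm.shift (if n < k then τ n else σ n)
        have hψ : ∀ t, ψ.inst t =
            φ.subst fun n => if n = k then t else if n < k then τ n else σ n := by
          intro t
          rw [Fml.inst_eq, Fml.subst_subst]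
          congr 1; funext n
          by_cases hn : n = k
          · simp only [hn, if_true]; rfl
          · simp only [hn, if_false, Tm.shift_subst_scons, Tm.subst_var]
        have h' := eqSubst ψ (h k hk) (by
          rw [hψ]
          convert ih using 3 with n
          grind)
        rw [hψ] at h'
        convert h' using 3 with n
        grind
      · rw [Fml.subst_congr (τ := fun n => if n < k then τ n else σ n)]
        · exact ih
        · intro n hn
          have : n ≠ k := fun e => hk (e ▸ hn)
          grind
  obtain ⟨N, hN⟩ := φ.exists_FV_lt
  have h' := key N
  rwa [Fml.subst_congr (τ := τ) φ fun n hn => if_pos (hN n hn)] at h'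

theorem app_congr {n : ℕ} (f : PRSymbol n) {s t : Fin n → Tm}
    (h : ∀ i, Derives T Γ (Fml.eq (s i) (t i))) :
    Derives T Γ (Fml.eq (Tm.app f s) (Tm.app f t)) := by
  -- In the template `φ` the variables below `n` are the arguments on the left, and the next `n`
  -- variables those on the right. Hence `val s s` and `val s t` differ only on the right, and `val
  -- s s` turns `φ` into an instance of reflexivity.
  let val (u v : Fin n → Tm) (m : ℕ) : Tm :=
    if h : m < n then u ⟨m, h⟩ else if h : m - n < n then v ⟨m - n, h⟩ else Tm.zero
  let φ := Fml.eq (Tm.app f fun i => Term.var i) (Tm.app f fun i => Term.var (n + i))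
  have hφ : ∀ u v, φ.subst (val u v) = Fml.eq (Tm.app f u) (Tm.app f v) := by
    intro u v
    simp [φ, Fml.subst, Tm.app, Term.subst, val]
  rw [← hφ]
  refine subst_eq (σ := val s s) (fun m _ => ?_) (by rw [hφ]; exact eqRefl _)
  by_cases h₁ : m < n
  · simpa only [val, h₁, dite_true] using eqRefl _
  · by_cases h₂ : m - n < n
    · simpa only [val, h₁, h₂, dite_true, dite_false] using h _
    · simpa only [val, h₁, h₂, dite_false] using eqRefl _

theorem succ_congr {s t : Tm} (h : Derives T Γ (Fml.eq s t)) :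
    Derives T Γ (Fml.eq s.succ t.succ) := app_congr _ fun _ => h

end Derives

@[simp] theorem Tm.succ_subst (t : Tm) (σ : ℕ → Tm) : t.succ.subst σ = Tm.succ (t.subst σ) := rfl

@[simp] theorem Tm.zero_subst (σ : ℕ → Tm) : Tm.zero.subst σ = Tm.zero := by
  simp only [Tm.zero, Tm.app, Term.subst, Term.func.injEq, heq_eq_eq, true_and]
  funext i
  exact i.elim0

/-! ### Elementary arithmetic -/

namespace Derives

variable {T : Set Fml} {Γ Δ : List Fml} {φ ψ χ : Fml}

theorem nat_induction (H : ∀ φ ∈ HA, Proves T φ) (φ : Fml) (h₀ : Derives T Γ (φ.inst Tm.zero))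
    (h₁ : ∀ Δ t, Γ ⊆ Δ → Derives T Δ (φ.inst t) → Derives T Δ (φ.inst t.succ)) (t : Tm) :
    Derives T Γ (φ.inst t) := by
  refine allE t (impE (of_proves (H _ (HA.induction φ))) (andI h₀ (all_intro fun u => ?_)))
  refine imp_intro (φ := φ.inst u) (ψ := φ.stepSucc.inst u) fun Δ hΔ h => ?_
  rw [Fml.stepSucc_inst]
  exact h₁ Δ u hΔ h

theorem succ_ne_zero (H : ∀ φ ∈ HA, Proves T φ) {t : Tm}
    (h : Derives T Γ (Fml.eq t.succ Tm.zero)) : Derives T Γ φ :=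
  falsumE (impE (of_proves (H _ (HA.succ_ne_zero t))) h)

theorem succ_inj (H : ∀ φ ∈ HA, Proves T φ) {s t : Tm}
    (h : Derives T Γ (Fml.eq s.succ t.succ)) : Derives T Γ (Fml.eq s t) :=
  impE (of_proves (H _ (HA.succ_inj s t))) h

theorem zero_or_succ (H : ∀ φ ∈ HA, Proves T φ) (t : Tm)
    (h₀ : ∀ Δ, Γ ⊆ Δ → Derives T Δ (Fml.eq t Tm.zero) → Derives T Δ χ)
    (h₁ : ∀ Δ u, Γ ⊆ Δ → Derives T Δ (Fml.eq t (Tm.succ u)) → Derives T Δ χ) :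
    Derives T Γ χ := by
  let φ := Fml.or (Fml.eq (Term.var 0) Tm.zero) (Fml.ex (Fml.eq (Term.var 1) (Tm.succ (Term.var 0))))
  let ψ (t : Tm) : Fml := Fml.eq t.shift (Tm.succ (Term.var 0))
  have hφ : ∀ t, φ.inst t = Fml.or (Fml.eq t Tm.zero) (Fml.ex (ψ t)) := by
    intro t
    simp [φ, ψ, Fml.inst_eq, Fml.subst, Term.subst, Fml.up]
    exact Tm.relabel_eq_subst _ _
  have hψ : ∀ t u, (ψ t).inst u = Fml.eq t u.succ := by
    intro t u
    simp [ψ, Fml.inst_eq, Fml.subst, Tm.subst_var, Term.subst]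
  have h := nat_induction (Γ := Γ) H φ (by rw [hφ]; exact orI₁ (eqRefl _))
    (fun Δ u _ _ => by rw [hφ]; exact orI₂ (exI u (by rw [hψ]; exact eqRefl _))) t
  rw [hφ] at h
  refine or_elim h h₀ fun Δ hΔ h => ex_elim h fun Δ' u hΔ' h => ?_
  rw [hψ] at h
  exact h₁ Δ' u (fun _ hx => hΔ' (hΔ hx)) h

/-- Induction on `s` with `t` universally quantified: comparing two successors leads back to their
predecessors, so `t` changes in the induction step. -/
theorem eq_decidable (H : ∀ φ ∈ HA, Proves T φ) (s t : Tm) :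
    Derives T Γ (Fml.or (Fml.eq s t) (Fml.neg (Fml.eq s t))) := by
  let ψ (s : Tm) : Fml :=
    Fml.or (Fml.eq s.shift (Term.var 0)) (Fml.neg (Fml.eq s.shift (Term.var 0)))
  let φ := Fml.all (Fml.or (Fml.eq (Term.var 1) (Term.var 0))
    (Fml.neg (Fml.eq (Term.var 1) (Term.var 0))))
  have hφ : ∀ t, φ.inst t = Fml.all (ψ t) := by
    intro t
    simp [φ, ψ, Fml.inst_eq, Fml.subst, Term.subst, Fml.up]
    exact Tm.relabel_eq_subst _ _
  have hψ : ∀ s t, (ψ s).inst t = Fml.or (Fml.eq s t) (Fml.neg (Fml.eq s t)) := by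
    intro t u
    simp [ψ, Fml.inst_eq, Fml.subst, Tm.subst_var, Term.subst]
  have h := nat_induction (Γ := Γ) H φ ?_ ?_ s
  · rw [hφ] at h
    rw [← hψ]
    exact allE t h
  · rw [hφ]
    refine all_intro fun t => ?_
    rw [hψ]
    refine zero_or_succ H t (fun Δ _ h => orI₁ (eq_symm h)) fun Δ u _ h => orI₂ ?_
    exact imp_intro fun Δ' hΔ' h' => succ_ne_zero H (eq_symm (eq_trans h' (h.mono hΔ')))
  · intro Δ s hΔ ih
    rw [hφ] at ih ⊢
    refine all_intro fun t => ?_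
    rw [hψ]
    refine zero_or_succ H t (fun Δ _ h => orI₂ ?_) fun Δ u hΔ h => ?_
    · exact imp_intro fun Δ' hΔ' h' => succ_ne_zero H (eq_trans h' (h.mono hΔ'))
    · have ih := allE u (ih.mono hΔ)
      rw [hψ] at ih
      refine or_elim ih (fun Δ' hΔ' h' => orI₁ (eq_trans (succ_congr h') (eq_symm (h.mono hΔ')))) ?_
      refine fun Δ' hΔ' h' => orI₂ (imp_intro fun Δ'' hΔ'' h'' => impE (h'.mono hΔ'') ?_)
      exact succ_inj H (eq_trans h'' ((h.mono hΔ').mono hΔ''))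

/-! ### Decidable and stable formulas -/

theorem not_or_intro (h₁ : Derives T Γ (Fml.neg φ))
    (h₂ : Derives T Γ (Fml.neg ψ)) : Derives T Γ (Fml.neg (Fml.or φ ψ)) :=
  imp_intro fun _ hΔ h => or_elim h (fun _ hΔ' h => impE ((h₁.mono hΔ).mono hΔ') h)
    fun _ hΔ' h => impE ((h₂.mono hΔ).mono hΔ') h

theorem decidable_of_QF (H : ∀ φ ∈ HA, Proves T φ) : ∀ (φ : Fml), φ.QF → ∀ {Γ : List Fml},
    Derives T Γ (Fml.or φ (Fml.neg φ))
  | .falsum, _, _ => orI₂ (imp_intro fun _ _ h => h)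
  | .eq s t, _, _ => eq_decidable H s t
  | .and φ ψ, h, _ =>
    or_elim (decidable_of_QF H φ h.1)
      (fun _ _ h₁ => or_elim (decidable_of_QF H ψ h.2)
        (fun _ hΔ h₂ => orI₁ (andI (h₁.mono hΔ) h₂))
        fun _ _ h₂ => orI₂ (imp_intro fun _ hΔ h => impE (h₂.mono hΔ) (andE₂ h)))
      fun _ _ h₁ => orI₂ (imp_intro fun _ hΔ h => impE (h₁.mono hΔ) (andE₁ h))
  | .or φ ψ, h, _ =>
    or_elim (decidable_of_QF H φ h.1) (fun _ _ h₁ => orI₁ (orI₁ h₁))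
      fun _ _ h₁ => or_elim (decidable_of_QF H ψ h.2) (fun _ _ h₂ => orI₁ (orI₂ h₂))
        fun _ hΔ h₂ => orI₂ (not_or_intro (h₁.mono hΔ) h₂)
  | .imp φ ψ, h, _ =>
    or_elim (decidable_of_QF H ψ h.2) (fun _ _ h₂ => orI₁ (imp_intro fun _ hΔ _ => h₂.mono hΔ))
      fun _ _ h₂ => or_elim (decidable_of_QF H φ h.1)
        (fun _ hΔ h₁ => orI₂ (imp_intro fun _ hΔ' h =>
          impE ((h₂.mono hΔ).mono hΔ') (impE h (h₁.mono hΔ'))))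
        fun _ _ h₁ => orI₁ (imp_intro fun _ hΔ' h => falsumE (impE (h₁.mono hΔ') h))

end Derives

/-! ### A pairing function -/

def Tm.app₁ (F : PRSymbol 1) (a : Tm) : Tm := Tm.app F ![a]

def Tm.app₂ (F : PRSymbol 2) (a b : Tm) : Tm := Tm.app F ![a, b]

@[simp] theorem Tm.app₁_subst (F : PRSymbol 1) (a : Tm) (σ : ℕ → Tm) :
    (Tm.app₁ F a).subst σ = Tm.app₁ F (a.subst σ) := by
  simp only [Tm.app₁, Tm.app, Term.subst, Term.func.injEq, heq_eq_eq, true_and]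
  funext i; fin_cases i; rfl

@[simp] theorem Tm.app₂_subst (F : PRSymbol 2) (a b : Tm) (σ : ℕ → Tm) :
    (Tm.app₂ F a b).subst σ = Tm.app₂ F (a.subst σ) (b.subst σ) := by
  simp only [Tm.app₂, Tm.app, Term.subst, Term.func.injEq, heq_eq_eq, true_and]
  funext i; fin_cases i <;> rfl

namespace PRSymbol

/-- Addition. -/
def add : PRSymbol 2 := prec (proj 0) (comp succ ![proj 1])

/-- The predecessor function. -/
def pred : PRSymbol 1 := prec zero (proj 0)

/-- Truncated subtraction of the first argument from the second one. -/
def subFrom : PRSymbol 2 := prec (proj 0) (comp pred ![proj 1])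

/-- The function with the values `z + 1` at `(0, z)` and `w` at `(w + 1, z)`. -/
def nextDown : PRSymbol 2 := prec succ (proj 0)

/-- The sequence `0, 1, 0, 3, 2, 1, 0, 7, …`, composed of blocks that count down to `0`. -/
def countdown : PRSymbol 1 := prec zero (comp nextDown ![proj 1, proj 0])

/-- The function with the values `c + 1` at `(0, c)` and `c` at `(w + 1, c)`. -/
def bump : PRSymbol 2 := prec succ (proj 2)

/-- The number of the block of `countdown` to which an index belongs. -/
def block : PRSymbol 1 := prec zero (comp bump ![comp countdown ![proj 0], proj 1])

/-- The first component of the pair with a given code; the second one is `countdown`. -/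
def fstCode : PRSymbol 1 := comp subFrom ![countdown, block]

end PRSymbol

namespace Derives

open PRSymbol

variable {T : Set Fml} {Γ Δ : List Fml} {φ ψ χ : Fml} {a a' b b' m n s t x y z w : Tm}

-- Computation rules for the function symbols

theorem app₁_congr (F : PRSymbol 1) (h : Derives T Γ (Fml.eq a a')) :
    Derives T Γ (Fml.eq (Tm.app₁ F a) (Tm.app₁ F a')) :=
  app_congr F fun i => by fin_cases i; exact h

theorem app₂_congr (F : PRSymbol 2) (h₁ : Derives T Γ (Fml.eq a a'))
    (h₂ : Derives T Γ (Fml.eq b b')) : Derives T Γ (Fml.eq (Tm.app₂ F a b) (Tm.app₂ F a' b')) :=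
  app_congr F fun i => by fin_cases i; exacts [h₁, h₂]

theorem proj_eq (H : ∀ φ ∈ HA, Proves T φ) {n : ℕ} (i : Fin n) (t : Fin n → Tm) :
    Derives T Γ (Fml.eq (Tm.app (proj i) t) (t i)) := of_proves (H _ (HA.proj i t))

theorem comp₁_eq (H : ∀ φ ∈ HA, Proves T φ) {n : ℕ} (F : PRSymbol 1) (G : PRSymbol n)
    (t : Fin n → Tm) : Derives T Γ (Fml.eq (Tm.app (comp F ![G]) t) (Tm.app₁ F (Tm.app G t))) :=
  eq_trans (of_proves (H _ (HA.comp F ![G] t)))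
    (app_congr F fun i => by fin_cases i; exact eqRefl _)

theorem comp₂_eq (H : ∀ φ ∈ HA, Proves T φ) {n : ℕ} (F : PRSymbol 2) (G G' : PRSymbol n)
    (t : Fin n → Tm) :
    Derives T Γ (Fml.eq (Tm.app (comp F ![G, G']) t) (Tm.app₂ F (Tm.app G t) (Tm.app G' t))) :=
  eq_trans (of_proves (H _ (HA.comp F ![G, G'] t)))
    (app_congr F fun i => by fin_cases i <;> exact eqRefl _)

theorem prec₁_zero (H : ∀ φ ∈ HA, Proves T φ) (G : PRSymbol 2) :
    Derives T Γ (Fml.eq (Tm.app₁ (prec zero G) Tm.zero) Tm.zero) :=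
  eq_trans (of_proves (H _ (HA.prec_zero zero G ![]))) (app_congr zero fun i => i.elim0)

theorem prec₁_succ (H : ∀ φ ∈ HA, Proves T φ) (G : PRSymbol 2) (a : Tm) :
    Derives T Γ (Fml.eq (Tm.app₁ (prec zero G) a.succ)
      (Tm.app₂ G a (Tm.app₁ (prec zero G) a))) :=
  of_proves (H _ (HA.prec_succ zero G a ![]))

theorem prec₂_zero (H : ∀ φ ∈ HA, Proves T φ) (F : PRSymbol 1) (G : PRSymbol 3) (b : Tm) :
    Derives T Γ (Fml.eq (Tm.app₂ (prec F G) Tm.zero b) (Tm.app₁ F b)) :=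
  of_proves (H _ (HA.prec_zero F G ![b]))

theorem prec₂_succ (H : ∀ φ ∈ HA, Proves T φ) (F : PRSymbol 1) (G : PRSymbol 3) (a b : Tm) :
    Derives T Γ (Fml.eq (Tm.app₂ (prec F G) a.succ b)
      (Tm.app G ![a, Tm.app₂ (prec F G) a b, b])) :=
  of_proves (H _ (HA.prec_succ F G a ![b]))

theorem succ_app₁ (a : Tm) : Derives T Γ (Fml.eq (Tm.app₁ PRSymbol.succ a) a.succ) :=
  app_congr _ fun i => by fin_cases i; exact eqRefl _

theorem zero_add (H : ∀ φ ∈ HA, Proves T φ)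
    (b : Tm) : Derives T Γ (Fml.eq (Tm.app₂ add Tm.zero b) b) :=
  eq_trans (prec₂_zero H _ _ b) (proj_eq H 0 ![b])

theorem succ_add (H : ∀ φ ∈ HA, Proves T φ) (a b : Tm) :
    Derives T Γ (Fml.eq (Tm.app₂ add a.succ b) (Tm.app₂ add a b).succ) :=
  eq_trans (prec₂_succ H _ _ a b) (eq_trans (comp₁_eq H _ _ _)
    (eq_trans (succ_app₁ _) (succ_congr (proj_eq H 1 ![a, Tm.app₂ add a b, b]))))

theorem pred_succ (H : ∀ φ ∈ HA, Proves T φ)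
    (a : Tm) : Derives T Γ (Fml.eq (Tm.app₁ pred a.succ) a) :=
  eq_trans (prec₁_succ H _ a) (proj_eq H 0 _)

theorem zero_subFrom (H : ∀ φ ∈ HA, Proves T φ)
    (b : Tm) : Derives T Γ (Fml.eq (Tm.app₂ subFrom Tm.zero b) b) :=
  eq_trans (prec₂_zero H _ _ b) (proj_eq H 0 ![b])

theorem succ_subFrom (H : ∀ φ ∈ HA, Proves T φ) (a b : Tm) :
    Derives T Γ (Fml.eq (Tm.app₂ subFrom a.succ b) (Tm.app₁ pred (Tm.app₂ subFrom a b))) :=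
  eq_trans (prec₂_succ H _ _ a b) (eq_trans (comp₁_eq H _ _ _)
    (app₁_congr _ (proj_eq H 1 ![a, Tm.app₂ subFrom a b, b])))

theorem countdown_succ (H : ∀ φ ∈ HA, Proves T φ)
    (a : Tm) : Derives T Γ (Fml.eq (Tm.app₁ countdown a.succ)
    (Tm.app₂ nextDown (Tm.app₁ countdown a) a)) :=
  eq_trans (prec₁_succ H _ a) (eq_trans (comp₂_eq H _ _ _ _)
    (app₂_congr _ (proj_eq H 1 _) (proj_eq H 0 _)))

theorem countdown_of_zero (H : ∀ φ ∈ HA, Proves T φ)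
    (h : Derives T Γ (Fml.eq (Tm.app₁ countdown a) Tm.zero)) :
    Derives T Γ (Fml.eq (Tm.app₁ countdown a.succ) a.succ) :=
  eq_trans (countdown_succ H a) (eq_trans (app₂_congr _ h (eqRefl _))
    (eq_trans (prec₂_zero H _ _ a) (succ_app₁ a)))

theorem countdown_of_succ (H : ∀ φ ∈ HA, Proves T φ)
    (h : Derives T Γ (Fml.eq (Tm.app₁ countdown a) w.succ)) :
    Derives T Γ (Fml.eq (Tm.app₁ countdown a.succ) w) :=
  eq_trans (countdown_succ H a) (eq_trans (app₂_congr _ h (eqRefl _))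
    (eq_trans (prec₂_succ H _ _ w a) (proj_eq H 0 _)))

theorem block_succ (H : ∀ φ ∈ HA, Proves T φ) (a : Tm) : Derives T Γ (Fml.eq (Tm.app₁ block a.succ)
    (Tm.app₂ bump (Tm.app₁ countdown a) (Tm.app₁ block a))) :=
  eq_trans (prec₁_succ H _ a) (eq_trans (comp₂_eq H _ _ _ _)
    (app₂_congr _ (eq_trans (comp₁_eq H _ _ _) (app₁_congr _ (proj_eq H 0 _))) (proj_eq H 1 _)))

theorem block_of_zero (H : ∀ φ ∈ HA, Proves T φ)
    (h : Derives T Γ (Fml.eq (Tm.app₁ countdown a) Tm.zero)) :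
    Derives T Γ (Fml.eq (Tm.app₁ block a.succ) (Tm.app₁ block a).succ) :=
  eq_trans (block_succ H a) (eq_trans (app₂_congr _ h (eqRefl _))
    (eq_trans (prec₂_zero H _ _ _) (succ_app₁ _)))

theorem block_of_succ (H : ∀ φ ∈ HA, Proves T φ)
    (h : Derives T Γ (Fml.eq (Tm.app₁ countdown a) w.succ)) :
    Derives T Γ (Fml.eq (Tm.app₁ block a.succ) (Tm.app₁ block a)) :=
  eq_trans (block_succ H a) (eq_trans (app₂_congr _ h (eqRefl _))
    (eq_trans (prec₂_succ H _ _ w _) (proj_eq H 2 _)))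

theorem fstCode_eq (H : ∀ φ ∈ HA, Proves T φ) (a : Tm) : Derives T Γ (Fml.eq (Tm.app₁ fstCode a)
    (Tm.app₂ subFrom (Tm.app₁ countdown a) (Tm.app₁ block a))) := comp₂_eq H _ _ _ _

-- Laws of addition and truncated subtraction

theorem add_zero (H : ∀ φ ∈ HA, Proves T φ)
    (a : Tm) : Derives T Γ (Fml.eq (Tm.app₂ add a Tm.zero) a) := by
  have h := nat_induction (Γ := Γ) H
    (Fml.eq (Tm.app₂ add (Term.var 0) Tm.zero) (Term.var 0))
  simp only [Fml.inst_eq, Fml.subst, Term.subst, Tm.app₂_subst, Tm.zero_subst, scons_zero] at h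
  exact h (zero_add H _) (fun Δ t _ ih => eq_trans (succ_add H _ _) (succ_congr ih)) a

theorem add_succ (H : ∀ φ ∈ HA, Proves T φ) (a b : Tm) :
    Derives T Γ (Fml.eq (Tm.app₂ add a b.succ) (Tm.app₂ add a b).succ) := by
  have h := nat_induction (Γ := Γ) H
    (Fml.eq (Tm.app₂ add (Term.var 0) b.shift.succ) (Tm.app₂ add (Term.var 0) b.shift).succ)
  simp only [Fml.inst_eq, Fml.subst, Term.subst, Tm.app₂_subst, Tm.succ_subst, scons_zero,
    Tm.shift_subst_scons, Tm.subst_var] at h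
  exact h (eq_trans (zero_add H _) (succ_congr (eq_symm (zero_add H _))))
    (fun Δ t _ ih => eq_trans (succ_add H _ _)
      (succ_congr (eq_trans ih (eq_symm (succ_add H _ _))))) a

theorem add_assoc (H : ∀ φ ∈ HA, Proves T φ)
    (a b c : Tm) : Derives T Γ (Fml.eq (Tm.app₂ add a (Tm.app₂ add b c))
    (Tm.app₂ add (Tm.app₂ add a b) c)) := by
  have h := nat_induction (Γ := Γ) H
    (Fml.eq (Tm.app₂ add (Term.var 0) (Tm.app₂ add b.shift c.shift))
      (Tm.app₂ add (Tm.app₂ add (Term.var 0) b.shift) c.shift))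
  simp only [Fml.inst_eq, Fml.subst, Term.subst, Tm.app₂_subst, scons_zero,
    Tm.shift_subst_scons, Tm.subst_var] at h
  exact h (eq_trans (zero_add H _) (app₂_congr _ (eq_symm (zero_add H _)) (eqRefl _)))
    (fun Δ t _ ih => eq_trans (succ_add H _ _) (eq_trans (succ_congr ih) (eq_trans
      (eq_symm (succ_add H _ _)) (app₂_congr _ (eq_symm (succ_add H _ _)) (eqRefl _))))) a

theorem succ_subFrom_succ (H : ∀ φ ∈ HA, Proves T φ) (a b : Tm) :
    Derives T Γ (Fml.eq (Tm.app₂ subFrom a.succ b.succ) (Tm.app₂ subFrom a b)) := by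
  have h := nat_induction (Γ := Γ) H
    (Fml.eq (Tm.app₂ subFrom (Tm.succ (Term.var 0)) b.shift.succ)
      (Tm.app₂ subFrom (Term.var 0) b.shift))
  simp only [Fml.inst_eq, Fml.subst, Term.subst, Tm.app₂_subst, Tm.succ_subst, scons_zero,
    Tm.shift_subst_scons, Tm.subst_var] at h
  exact h (eq_trans (succ_subFrom H _ _) (eq_trans (app₁_congr _ (zero_subFrom H _))
      (eq_trans (pred_succ H _) (eq_symm (zero_subFrom H _)))))
    (fun Δ t _ ih => eq_trans (succ_subFrom H _ _) (eq_trans (app₁_congr _ ih)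
      (eq_symm (succ_subFrom H _ _)))) a

theorem subFrom_add (H : ∀ φ ∈ HA, Proves T φ) (a b : Tm) :
    Derives T Γ (Fml.eq (Tm.app₂ subFrom a (Tm.app₂ add b a)) b) := by
  have h := nat_induction (Γ := Γ) H
    (Fml.eq (Tm.app₂ subFrom (Term.var 0) (Tm.app₂ add b.shift (Term.var 0))) b.shift)
  simp only [Fml.inst_eq, Fml.subst, Term.subst, Tm.app₂_subst, scons_zero,
    Tm.shift_subst_scons, Tm.subst_var] at h
  exact h (eq_trans (zero_subFrom H _) (add_zero H _))
    (fun Δ t _ ih => eq_trans (app₂_congr _ (eqRefl _) (add_succ H _ _))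
      (eq_trans (succ_subFrom_succ H _ _) ih)) a

/-- The formula saying that `y` is a value of `countdown` in the block with number `n`. -/
def occurs (n y : Tm) : Fml := Fml.ex (Fml.and (Fml.eq (Tm.app₁ block (Term.var 0)) n.shift)
  (Fml.eq (Tm.app₁ countdown (Term.var 0)) y.shift))

theorem occurs_subst (n y : Tm) (σ : ℕ → Tm) :
    (occurs n y).subst σ = occurs (n.subst σ) (y.subst σ) := by
  simp [occurs, Fml.subst, Tm.shift, Tm.subst_subst, Term.subst]

theorem occurs_intro (z : Tm) (h₁ : Derives T Γ (Fml.eq (Tm.app₁ block z) n))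
    (h₂ : Derives T Γ (Fml.eq (Tm.app₁ countdown z) y)) : Derives T Γ (occurs n y) :=
  exI z (by simpa [Fml.inst_eq, Fml.subst, Term.subst, Tm.subst_var] using andI h₁ h₂)

theorem occurs_elim (h : Derives T Γ (occurs n y))
    (h' : ∀ Δ z, Γ ⊆ Δ → Derives T Δ (Fml.eq (Tm.app₁ block z) n) →
      Derives T Δ (Fml.eq (Tm.app₁ countdown z) y) → Derives T Δ χ) : Derives T Γ χ := by
  refine ex_elim h fun Δ z hΔ hz => ?_
  simp [Fml.inst_eq, Fml.subst, Term.subst, Tm.subst_var] at hz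
  exact h' Δ z hΔ (andE₁ hz) (andE₂ hz)

theorem occurs_of_succ (H : ∀ φ ∈ HA, Proves T φ)
    (h : Derives T Γ (occurs n y.succ)) : Derives T Γ (occurs n y) :=
  occurs_elim h fun _ z _ h₁ h₂ =>
    occurs_intro z.succ (eq_trans (block_of_succ H h₂) h₁) (countdown_of_succ H h₂)

theorem occurs_congr (h : Derives T Γ (occurs n y)) (h' : Derives T Γ (Fml.eq y x)) :
    Derives T Γ (occurs n x) :=
  occurs_elim h fun _ z hΔ h₁ h₂ => occurs_intro z h₁ (eq_trans h₂ (h'.mono hΔ))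

/-- A block counts down in steps of one, so the values occurring in it are closed downwards. -/
theorem occurs_of_add (H : ∀ φ ∈ HA, Proves T φ)
    (m n b : Tm) (h : Derives T Γ (occurs n (Tm.app₂ add m b))) :
    Derives T Γ (occurs n b) := by
  have h' := nat_induction (Γ := Γ) H
    (Fml.imp (occurs n.shift (Tm.app₂ add (Term.var 0) b.shift)) (occurs n.shift b.shift))
  simp only [Fml.inst_eq, Fml.subst, Term.subst, Tm.app₂_subst, scons_zero, occurs_subst,
    Tm.shift_subst_scons, Tm.subst_var] at h'
  refine impE (h' (imp_intro fun Δ _ h => occurs_congr h (zero_add H _)) ?_ m) h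
  exact fun Δ t _ ih => imp_intro fun Δ' hΔ' h =>
    impE (ih.mono hΔ') (occurs_of_succ H (occurs_congr h (succ_add H _ _)))

/-- An index is never smaller than the number of its block, since passing to the next index raises
the block number by at most one. -/
theorem exists_eq_add_block (H : ∀ φ ∈ HA, Proves T φ) (z : Tm)
    (hχ : ∀ Δ m, Γ ⊆ Δ → Derives T Δ (Fml.eq z (Tm.app₂ add m (Tm.app₁ block z))) →
      Derives T Δ χ) : Derives T Γ χ := by
  let ψ (z : Tm) := Fml.eq z.shift (Tm.app₂ add (Term.var 0) (Tm.app₁ block z.shift))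
  let φ := Fml.ex (Fml.eq (Term.var 1) (Tm.app₂ add (Term.var 0) (Tm.app₁ block (Term.var 1))))
  have hφ : ∀ t, φ.inst t = Fml.ex (ψ t) := by
    intro t
    simp [φ, ψ, Fml.inst_eq, Fml.subst, Term.subst, Fml.up]
    rw [Tm.relabel_eq_subst]; exact ⟨rfl, rfl⟩
  have hψ : ∀ z m, (ψ z).inst m = Fml.eq z (Tm.app₂ add m (Tm.app₁ block z)) := by
    intro z m
    simp [ψ, Fml.inst_eq, Fml.subst, Term.subst, Tm.subst_var]
  have h := nat_induction (Γ := Γ) H φ ?_ ?_ z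
  · rw [hφ] at h
    exact ex_elim h fun Δ m hΔ hm => hχ Δ m hΔ (by rwa [hψ] at hm)
  · rw [hφ]
    refine exI Tm.zero ?_
    rw [hψ]
    exact eq_symm (eq_trans (zero_add H _) (prec₁_zero H _))
  · intro Δ z _ ih
    rw [hφ] at ih ⊢
    refine ex_elim ih fun Δ m _ hm => ?_
    rw [hψ] at hm
    refine zero_or_succ H (Tm.app₁ countdown z) (fun Δ hΔ h => exI m ?_)
      fun Δ w hΔ h => exI m.succ ?_
    · rw [hψ]
      exact eq_trans (succ_congr (hm.mono hΔ)) (eq_symm (eq_trans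
        (app₂_congr _ (eqRefl _) (block_of_zero H h)) (add_succ H _ _)))
    · rw [hψ]
      exact eq_trans (succ_congr (hm.mono hΔ)) (eq_symm (eq_trans
        (app₂_congr _ (eqRefl _) (block_of_succ H h)) (succ_add H _ _)))

/-- Block `n` contains a value that is at least `n` (in fact it starts with `2^n - 1`). This makes
every number up to `n` available in block `n`. -/
theorem exists_occurs_add (H : ∀ φ ∈ HA, Proves T φ) (n : Tm)
    (hχ : ∀ Δ m, Γ ⊆ Δ → Derives T Δ (occurs n (Tm.app₂ add m n)) → Derives T Δ χ) :
    Derives T Γ χ := by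
  let ψ (n : Tm) := occurs n.shift (Tm.app₂ add (Term.var 0) n.shift)
  let φ := Fml.ex (occurs (Term.var 1) (Tm.app₂ add (Term.var 0) (Term.var 1)))
  have hφ : ∀ t, φ.inst t = Fml.ex (ψ t) := by
    intro t
    simp [φ, ψ, Fml.inst_eq, Fml.subst, Term.subst, occurs_subst, Fml.up]
    rw [Tm.relabel_eq_subst]; rfl
  have hψ : ∀ n m, (ψ n).inst m = occurs n (Tm.app₂ add m n) := by
    intro z m
    simp [ψ, Fml.inst_eq, Term.subst, occurs_subst, Tm.subst_var]
  have h := nat_induction (Γ := Γ) H φ ?_ ?_ n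
  · rw [hφ] at h
    exact ex_elim h fun Δ m hΔ hm => hχ Δ m hΔ (by rwa [hψ] at hm)
  · rw [hφ]
    refine exI Tm.zero ?_
    rw [hψ]
    exact occurs_intro Tm.zero (prec₁_zero H _)
      (eq_trans (prec₁_zero H _) (eq_symm (zero_add H _)))
  · intro Δ n _ ih
    rw [hφ] at ih ⊢
    refine ex_elim ih fun Δ m _ hm => ?_
    rw [hψ] at hm
    -- The block counts down to `0`, say at index `z`. Block `n + 1` then starts at index `z + 1`
    -- with value `z + 1`, and `z` is at least its block number `n`.
    have h₀ : Derives T Δ (occurs n Tm.zero) :=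
      occurs_of_add H (Tm.app₂ add m n) _ _ (occurs_congr hm (eq_symm (add_zero H _)))
    refine occurs_elim h₀ fun Δ z _ h₁ h₂ => exists_eq_add_block H z fun Δ' m hΔ' hm => ?_
    replace h₁ := h₁.mono hΔ'
    replace h₂ := h₂.mono hΔ'
    refine exI m ?_
    rw [hψ]
    refine occurs_intro z.succ (eq_trans (block_of_zero H h₂) (succ_congr h₁))
      (eq_trans (countdown_of_zero H h₂) ?_)
    exact eq_trans (succ_congr (eq_trans hm (app₂_congr _ (eqRefl _) h₁)))
      (eq_symm (add_succ H _ _))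

/-- The code of `(x, y)` is the index in block `x + y` at which the value is `y`; the first
component is recovered as block number minus value. This needs only addition and truncated
subtraction. -/
theorem exists_pair (H : ∀ φ ∈ HA, Proves T φ) (x y : Tm)
    (hχ : ∀ Δ z, Γ ⊆ Δ → Derives T Δ (Fml.eq (Tm.app₁ fstCode z) x) →
      Derives T Δ (Fml.eq (Tm.app₁ countdown z) y) → Derives T Δ χ) : Derives T Γ χ := by
  refine exists_occurs_add H (Tm.app₂ add x y) fun Δ m hΔ h => ?_
  refine occurs_elim (occurs_of_add H (Tm.app₂ add m x) _ y (occurs_congr h (add_assoc H _ _ _)))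
    fun Δ' z hΔ' h₁ h₂ => hχ Δ' z (fun _ hx => hΔ' (hΔ hx)) ?_ h₂
  exact eq_trans (fstCode_eq H z) (eq_trans (app₂_congr _ h₂ h₁) (subFrom_add H _ _))

/-- The `n`-th component of a sequence with a given code. -/
def component : ℕ → Tm → Tm
  | 0, z => Tm.app₁ fstCode z
  | n + 1, z => component n (Tm.app₁ countdown z)

theorem component_subst (n : ℕ) (z : Tm) (σ : ℕ → Tm) :
    (component n z).subst σ = component n (z.subst σ) := by
  induction n generalizing z with
  | zero => exact Tm.app₁_subst ..
  | succ n ih => rw [component, ih, Tm.app₁_subst, component]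

theorem component_congr (n : ℕ) (h : Derives T Γ (Fml.eq s t)) :
    Derives T Γ (Fml.eq (component n s) (component n t)) := by
  induction n generalizing s t with
  | zero => exact app₁_congr _ h
  | succ n ih => exact ih (app₁_congr _ h)

theorem exists_code (H : ∀ φ ∈ HA, Proves T φ) (σ : ℕ → Tm) (N : ℕ)
    (hχ : ∀ Δ z, Γ ⊆ Δ → (∀ n < N, Derives T Δ (Fml.eq (component n z) (σ n))) →
      Derives T Δ χ) : Derives T Γ χ := by
  induction N generalizing σ Γ with
  | zero => exact hχ Γ Tm.zero (fun _ h => h) (by simp)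
  | succ N ih =>
    -- The number `u` codes the tail of the sequence, and `z` the pair of the head and `u`. What
    -- lies beyond the first `N` components is immaterial.
    refine ih (fun n => σ (n + 1)) fun Δ u hΔ hu => ?_
    refine exists_pair H (σ 0) u fun Δ' z hΔ' h₁ h₂ => ?_
    refine hχ Δ' z (fun _ hx => hΔ' (hΔ hx)) fun n hn => ?_
    cases n with
    | zero => exact h₁
    | succ n => exact eq_trans (component_congr n h₂) ((hu n (by omega)).mono hΔ')

end Derives

/-! ### Provable equivalence -/

/-- `φ` and `ψ` have the same free variables and are equivalent in `T`. -/
structure Eqv (T : Set Fml) (φ ψ : Fml) : Prop where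
  fv : φ.FV = ψ.FV
  mp : ∀ Γ, Derives T Γ φ → Derives T Γ ψ
  mpr : ∀ Γ, Derives T Γ ψ → Derives T Γ φ

namespace Eqv

open Derives

variable {T : Set Fml} {φ ψ χ φ' ψ' : Fml}

theorem refl (φ : Fml) : Eqv T φ φ := ⟨rfl, fun _ h => h, fun _ h => h⟩

theorem trans (h₁ : Eqv T φ ψ) (h₂ : Eqv T ψ χ) : Eqv T φ χ :=
  ⟨h₁.fv.trans h₂.fv, fun Γ h => h₂.mp Γ (h₁.mp Γ h), fun Γ h => h₁.mpr Γ (h₂.mpr Γ h)⟩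

theorem of_proves (hFV : φ.FV = ψ.FV) (h : Proves T (Fml.iff φ ψ)) : Eqv T φ ψ :=
  ⟨hFV, fun _ h' => impE (Derives.of_proves (andE₁ h)) h',
    fun _ h' => impE (Derives.of_proves (andE₂ h)) h'⟩

theorem proves (h : Eqv T φ ψ) : Proves T (Fml.iff φ ψ) :=
  andI (imp_intro fun _ _ h' => h.mp _ h') (imp_intro fun _ _ h' => h.mpr _ h')

theorem subst (h : Eqv T φ ψ) (σ : ℕ → Tm) : Eqv T (φ.subst σ) (ψ.subst σ) :=
  of_proves (by ext m; simp only [Fml.mem_FV_subst, h.fv]) (proves_subst h.proves σ)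

theorem inst (h : Eqv T φ ψ) (t : Tm) : Eqv T (φ.inst t) (ψ.inst t) := h.subst _

-- Equivalence is a congruence

theorem and (h₁ : Eqv T φ φ') (h₂ : Eqv T ψ ψ') : Eqv T (Fml.and φ ψ) (Fml.and φ' ψ') :=
  ⟨by simp only [Fml.FV, h₁.fv, h₂.fv],
    fun _ h => andI (h₁.mp _ (andE₁ h)) (h₂.mp _ (andE₂ h)),
    fun _ h => andI (h₁.mpr _ (andE₁ h)) (h₂.mpr _ (andE₂ h))⟩

theorem or (h₁ : Eqv T φ φ') (h₂ : Eqv T ψ ψ') : Eqv T (Fml.or φ ψ) (Fml.or φ' ψ') :=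
  ⟨by simp only [Fml.FV, h₁.fv, h₂.fv],
    fun _ h => or_elim h (fun _ _ h => orI₁ (h₁.mp _ h)) fun _ _ h => orI₂ (h₂.mp _ h),
    fun _ h => or_elim h (fun _ _ h => orI₁ (h₁.mpr _ h)) fun _ _ h => orI₂ (h₂.mpr _ h)⟩

theorem imp (h₁ : Eqv T φ φ') (h₂ : Eqv T ψ ψ') : Eqv T (Fml.imp φ ψ) (Fml.imp φ' ψ') :=
  ⟨by simp only [Fml.FV, h₁.fv, h₂.fv],
    fun _ h => imp_intro fun _ hΔ h' => h₂.mp _ (impE (h.mono hΔ) (h₁.mpr _ h')),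
    fun _ h => imp_intro fun _ hΔ h' => h₂.mpr _ (impE (h.mono hΔ) (h₁.mp _ h'))⟩

theorem neg (h : Eqv T φ φ') : Eqv T (Fml.neg φ) (Fml.neg φ') := h.imp (refl _)

theorem all (h : Eqv T φ φ') : Eqv T (Fml.all φ) (Fml.all φ') :=
  ⟨by simp only [Fml.FV, h.fv],
    fun _ h' => all_intro fun t => (h.inst t).mp _ (allE t h'),
    fun _ h' => all_intro fun t => (h.inst t).mpr _ (allE t h')⟩

theorem ex (h : Eqv T φ φ') : Eqv T (Fml.ex φ) (Fml.ex φ') :=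
  ⟨by simp only [Fml.FV, h.fv],
    fun _ h' => ex_elim h' fun _ t _ h' => exI t ((h.inst t).mp _ h'),
    fun _ h' => ex_elim h' fun _ t _ h' => exI t ((h.inst t).mpr _ h')⟩

-- Intuitionistically valid quantifier shifts

theorem and_comm (φ ψ : Fml) : Eqv T (Fml.and φ ψ) (Fml.and ψ φ) :=
  ⟨Set.union_comm _ _, fun _ h => andI (andE₂ h) (andE₁ h), fun _ h => andI (andE₂ h) (andE₁ h)⟩

theorem or_comm (φ ψ : Fml) : Eqv T (Fml.or φ ψ) (Fml.or ψ φ) :=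
  ⟨Set.union_comm _ _, fun _ h => or_elim h (fun _ _ => orI₂) fun _ _ => orI₁,
    fun _ h => or_elim h (fun _ _ => orI₂) fun _ _ => orI₁⟩

theorem ex_shift (φ : Fml) : Eqv T φ (Fml.ex φ.shift) :=
  ⟨by ext; simp [Fml.FV], fun _ h => exI Tm.zero (by rwa [Fml.shift_inst]),
    fun _ h => ex_elim h fun _ _ _ h => by rwa [Fml.shift_inst] at h⟩

theorem all_shift (φ : Fml) : Eqv T φ (Fml.all φ.shift) :=
  ⟨by ext; simp [Fml.FV], fun _ h => all_intro fun _ => by rwa [Fml.shift_inst],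
    fun _ h => by simpa using allE Tm.zero h⟩

theorem ex_and (φ ψ : Fml) : Eqv T (Fml.and (Fml.ex φ) ψ) (Fml.ex (Fml.and φ ψ.shift)) where
  fv := by ext; simp [Fml.FV]
  mp _ h := ex_elim (andE₁ h) fun _ t hΔ h' =>
    exI t (andI h' (by rw [← Fml.inst, Fml.shift_inst]; exact (andE₂ h).mono hΔ))
  mpr _ h := ex_elim h fun _ t _ h => by
    change Derives T _ (Fml.and (φ.inst t) (ψ.shift.inst t)) at h
    rw [Fml.shift_inst] at h
    exact andI (exI t (andE₁ h)) (andE₂ h)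

theorem and_ex (φ ψ : Fml) : Eqv T (Fml.and φ (Fml.ex ψ)) (Fml.ex (Fml.and φ.shift ψ)) :=
  (and_comm _ _).trans ((ex_and ψ φ).trans (and_comm _ _).ex)

theorem all_and (φ ψ : Fml) : Eqv T (Fml.and (Fml.all φ) ψ) (Fml.all (Fml.and φ ψ.shift)) where
  fv := by ext; simp [Fml.FV]
  mp _ h := all_intro fun t =>
    andI (allE t (andE₁ h)) (by rw [← Fml.inst, Fml.shift_inst]; exact andE₂ h)
  mpr _ h := by
    have h' (t : Tm) : Derives T _ (Fml.and (φ.inst t) (ψ.shift.inst t)) := allE t h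
    simp only [Fml.shift_inst] at h'
    exact andI (all_intro fun t => andE₁ (h' t)) (andE₂ (h' Tm.zero))

theorem and_all (φ ψ : Fml) : Eqv T (Fml.and φ (Fml.all ψ)) (Fml.all (Fml.and φ.shift ψ)) :=
  (and_comm _ _).trans ((all_and ψ φ).trans (and_comm _ _).all)

theorem ex_or (φ ψ : Fml) : Eqv T (Fml.or (Fml.ex φ) ψ) (Fml.ex (Fml.or φ ψ.shift)) where
  fv := by ext; simp [Fml.FV]
  mp _ h := or_elim h (fun _ _ h => ex_elim h fun _ t _ h => exI t (orI₁ h)) fun _ _ h =>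
    exI Tm.zero (orI₂ (by rw [← Fml.inst, Fml.shift_inst]; exact h))
  mpr _ h := ex_elim h fun _ t _ h => by
    change Derives T _ (Fml.or (φ.inst t) (ψ.shift.inst t)) at h
    rw [Fml.shift_inst] at h
    exact or_elim h (fun _ _ h => orI₁ (exI t h)) fun _ _ h => orI₂ h

theorem or_ex (φ ψ : Fml) : Eqv T (Fml.or φ (Fml.ex ψ)) (Fml.ex (Fml.or φ.shift ψ)) :=
  (or_comm _ _).trans ((ex_or ψ φ).trans (or_comm _ _).ex)

theorem ex_imp (φ ψ : Fml) : Eqv T (Fml.imp (Fml.ex φ) ψ) (Fml.all (Fml.imp φ ψ.shift)) where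
  fv := by ext; simp [Fml.FV]
  mp _ h := all_intro fun t => by
    change Derives T _ (Fml.imp (φ.inst t) (ψ.shift.inst t))
    rw [Fml.shift_inst]
    exact imp_intro fun _ hΔ h' => impE (h.mono hΔ) (exI t h')
  mpr _ h := by
    have h' (t : Tm) : Derives T _ (Fml.imp (φ.inst t) (ψ.shift.inst t)) := allE t h
    simp only [Fml.shift_inst] at h'
    exact imp_intro fun _ hΔ h => ex_elim h fun _ t hΔ' h => impE (((h' t).mono hΔ).mono hΔ') h

theorem imp_all (φ ψ : Fml) : Eqv T (Fml.imp φ (Fml.all ψ)) (Fml.all (Fml.imp φ.shift ψ)) where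
  fv := by ext; simp [Fml.FV]
  mp _ h := all_intro fun t => by
    change Derives T _ (Fml.imp (φ.shift.inst t) (ψ.inst t))
    rw [Fml.shift_inst]
    exact imp_intro fun _ hΔ h' => allE t (impE (h.mono hΔ) h')
  mpr _ h := by
    have h' (t : Tm) : Derives T _ (Fml.imp (φ.shift.inst t) (ψ.inst t)) := allE t h
    simp only [Fml.shift_inst] at h'
    exact imp_intro fun _ hΔ h => all_intro fun t => impE ((h' t).mono hΔ) h

theorem not_ex (φ : Fml) : Eqv T (Fml.neg (Fml.ex φ)) (Fml.all (Fml.neg φ)) := ex_imp φ Fml.falsum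

end Eqv

/-! ### Stable formulas -/

/-- Double negation elimination for the formula `φ`. -/
def Stable (T : Set Fml) (φ : Fml) : Prop :=
  ∀ Γ, Derives T Γ (Fml.neg (Fml.neg φ)) → Derives T Γ φ

/-- Excluded middle for the formula `φ`. -/
def Decides (T : Set Fml) (φ : Fml) : Prop := ∀ Γ, Derives T Γ (Fml.or φ (Fml.neg φ))

section Stable

open Derives

variable {T : Set Fml} {φ ψ : Fml}

theorem Eqv.stable (h : Eqv T φ ψ) (hψ : Stable T ψ) : Stable T φ :=
  fun _ h' => h.mpr _ (hψ _ (h.neg.neg.mp _ h'))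

theorem Eqv.decides (h : Eqv T φ ψ) (hψ : Decides T ψ) : Decides T φ :=
  fun _ => (h.or h.neg).mpr _ (hψ _)

theorem Decides.stable (h : Decides T φ) : Stable T φ :=
  fun Γ h' => or_elim (h Γ) (fun _ _ h => h) fun _ hΔ h => falsumE (impE (h'.mono hΔ) h)

theorem Decides.subst (h : Decides T φ) (σ : ℕ → Tm) : Decides T (φ.subst σ) :=
  fun _ => of_proves (proves_subst (h []) σ)

theorem Stable.subst (h : Stable T φ) (σ : ℕ → Tm) : Stable T (φ.subst σ) := by
  have h' : Proves T (Fml.imp (Fml.neg (Fml.neg φ)) φ) := imp_intro fun _ _ h' => h _ h'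
  exact fun _ h'' => impE (of_proves (proves_subst h' σ)) h''

theorem Stable.all (h : Stable T φ) : Stable T (Fml.all φ) := fun _ h' =>
  all_intro fun t => h.subst _ _ (imp_intro fun _ hΔ h₁ => impE (h'.mono hΔ)
    (imp_intro fun _ hΔ h₂ => impE (h₁.mono hΔ) (allE t h₂)))

/-- Parameters can be coded by a single one. -/
theorem stable_of_coded (H : ∀ φ ∈ HA, Proves T φ) {χ : Fml}
    (h : χ = φ.subst (fun n => component n (Term.var 0)))
    (hχ : Proves T (Fml.all (Fml.imp (Fml.neg (Fml.neg χ)) χ))) : Stable T φ := by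
  intro Γ hΓ
  obtain ⟨N, hN⟩ := φ.exists_FV_lt
  -- Let `z` code the values of all variables that occur in `φ`. The instance of `χ` at `z` then has
  -- the components of `z` where `φ` has its variables, and provable equality carries the statement
  -- over in both directions.
  refine exists_code H Term.var N fun Δ z hΔ hz => ?_
  have hinst : χ.inst z = φ.subst (fun n => component n z) := by
    rw [h, Fml.inst_eq, Fml.subst_subst]
    congr 1; funext n
    exact component_subst n _ _
  have h₁ : Derives T Δ (Fml.imp (Fml.neg (Fml.neg (χ.inst z))) (χ.inst z)) :=
    allE z (of_proves hχ)
  rw [hinst] at h₁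
  have hFV : (Fml.neg (Fml.neg φ)).FV = φ.FV := by simp [Fml.FV]
  have h₂ : Derives T Δ ((Fml.neg (Fml.neg φ)).subst fun n => component n z) := by
    refine subst_eq (σ := Term.var) (fun n hn => eq_symm (hz n (hN n ?_))) ?_
    · rwa [hFV] at hn
    · rw [Fml.subst_var]; exact hΓ.mono hΔ
  have h₃ := subst_eq (τ := Term.var) (fun n hn => hz n (hN n hn)) (impE h₁ h₂)
  rwa [Fml.subst_var] at h₃

theorem FV_coded (φ : Fml) : (φ.subst fun n => component n (Term.var 0)).FV ⊆ {0} := by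
  have h : ∀ n (z : Tm), (component n z).varFinset = z.varFinset := by
    intro n
    induction n with
    | zero => intro z; ext; simp [component, Tm.app₁, Tm.app, Term.varFinset]
    | succ n ih => intro z; ext; simp [component, ih, Tm.app₁, Tm.app, Term.varFinset]
  intro m hm
  obtain ⟨n, _, hm⟩ := (Fml.mem_FV_subst _ _ _).1 hm
  simpa [h, Term.varFinset] using hm

end Stable

/-! ### Prenex classes -/

section Classes

variable {k : ℕ} {φ ψ : Fml}

theorem Fml.QF.subst : ∀ {φ : Fml}, φ.QF → ∀ σ, (φ.subst σ).QF
  | .falsum, _, _ => trivial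
  | .eq _ _, _, _ => trivial
  | .and _ _, h, σ => ⟨h.1.subst σ, h.2.subst σ⟩
  | .or _ _, h, σ => ⟨h.1.subst σ, h.2.subst σ⟩
  | .imp _ _, h, σ => ⟨h.1.subst σ, h.2.subst σ⟩

theorem ex_mem_sigmaClass_of_pi (h : φ ∈ PiClass k) : Fml.ex φ ∈ SigmaClass (k + 1) := by
  rw [SigmaClass]; exact ⟨1, one_pos, φ, h, rfl⟩

theorem ex_mem_sigmaClass (h : φ ∈ SigmaClass (k + 1)) : Fml.ex φ ∈ SigmaClass (k + 1) := by
  rw [SigmaClass] at h ⊢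
  obtain ⟨n, _, ψ, hψ, rfl⟩ := h
  exact ⟨n + 1, n.succ_pos, ψ, hψ, (Function.iterate_succ_apply' _ _ _).symm⟩

theorem all_mem_piClass_of_sigma (h : φ ∈ SigmaClass k) : Fml.all φ ∈ PiClass (k + 1) := by
  rw [PiClass]; exact ⟨1, one_pos, φ, h, rfl⟩

theorem all_mem_piClass (h : φ ∈ PiClass (k + 1)) : Fml.all φ ∈ PiClass (k + 1) := by
  rw [PiClass] at h ⊢
  obtain ⟨n, _, ψ, hψ, rfl⟩ := h
  exact ⟨n + 1, n.succ_pos, ψ, hψ, (Function.iterate_succ_apply' _ _ _).symm⟩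

/-- Blocks are built one quantifier at a time from a `Π_k` matrix. In each step the formula below
the quantifier is either the matrix itself or already in `Σ_{k+1}`. -/
theorem sigmaClass_induction {Q : Fml → Prop} (base : ∀ ψ ∈ PiClass k, Q ψ)
    (step : ∀ ψ, Fml.ex ψ ∈ SigmaClass (k + 1) → (ψ ∈ PiClass k ∨ ψ ∈ SigmaClass (k + 1)) →
      Q ψ → Q (Fml.ex ψ)) : ∀ φ ∈ SigmaClass (k + 1), Q φ := by
  intro φ hφ
  rw [SigmaClass] at hφ
  obtain ⟨n, hn, ψ, hψ, rfl⟩ := hφ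
  induction n, hn using Nat.le_induction with
  | base => exact step ψ (ex_mem_sigmaClass_of_pi hψ) (Or.inl hψ) (base ψ hψ)
  | succ n hn ih =>
    have hmem : Fml.ex^[n] ψ ∈ SigmaClass (k + 1) := by rw [SigmaClass]; exact ⟨n, hn, ψ, hψ, rfl⟩
    rw [Function.iterate_succ_apply']
    exact step _ (ex_mem_sigmaClass hmem) (Or.inr hmem) ih

theorem piClass_induction {Q : Fml → Prop} (base : ∀ ψ ∈ SigmaClass k, Q ψ)
    (step : ∀ ψ, Fml.all ψ ∈ PiClass (k + 1) → (ψ ∈ SigmaClass k ∨ ψ ∈ PiClass (k + 1)) →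
      Q ψ → Q (Fml.all ψ)) : ∀ φ ∈ PiClass (k + 1), Q φ := by
  intro φ hφ
  rw [PiClass] at hφ
  obtain ⟨n, hn, ψ, hψ, rfl⟩ := hφ
  induction n, hn using Nat.le_induction with
  | base => exact step ψ (all_mem_piClass_of_sigma hψ) (Or.inl hψ) (base ψ hψ)
  | succ n hn ih =>
    have hmem : Fml.all^[n] ψ ∈ PiClass (k + 1) := by rw [PiClass]; exact ⟨n, hn, ψ, hψ, rfl⟩
    rw [Function.iterate_succ_apply']
    exact step _ (all_mem_piClass hmem) (Or.inr hmem) ih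

theorem ex_iterate_subst (ψ : Fml) (n : ℕ) (σ : ℕ → Tm) :
    (Fml.ex^[n] ψ).subst σ = Fml.ex^[n] (ψ.subst (Fml.up^[n] σ)) := by
  induction n generalizing σ with
  | zero => rfl
  | succ n ih =>
    rw [Function.iterate_succ_apply', Function.iterate_succ_apply', Function.iterate_succ_apply,
      Fml.subst, ih]

theorem all_iterate_subst (ψ : Fml) (n : ℕ) (σ : ℕ → Tm) :
    (Fml.all^[n] ψ).subst σ = Fml.all^[n] (ψ.subst (Fml.up^[n] σ)) := by
  induction n generalizing σ with
  | zero => rfl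
  | succ n ih =>
    rw [Function.iterate_succ_apply', Function.iterate_succ_apply', Function.iterate_succ_apply,
      Fml.subst, ih]

theorem subst_mem_classes (k : ℕ) :
    (∀ φ ∈ SigmaClass k, ∀ σ, φ.subst σ ∈ SigmaClass k) ∧
      ∀ φ ∈ PiClass k, ∀ σ, φ.subst σ ∈ PiClass k := by
  induction k with
  | zero =>
    simp only [SigmaClass, PiClass]
    exact ⟨fun φ h σ => Fml.QF.subst h σ, fun φ h σ => Fml.QF.subst h σ⟩
  | succ k ih =>
    simp only [SigmaClass, PiClass]
    constructor
    · rintro _ ⟨n, hn, ψ, hψ, rfl⟩ σ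
      exact ⟨n, hn, _, ih.2 ψ hψ _, ex_iterate_subst ψ n σ⟩
    · rintro _ ⟨n, hn, ψ, hψ, rfl⟩ σ
      exact ⟨n, hn, _, ih.1 ψ hψ _, all_iterate_subst ψ n σ⟩

theorem subst_mem_sigmaClass (h : φ ∈ SigmaClass k) (σ : ℕ → Tm) : φ.subst σ ∈ SigmaClass k :=
  (subst_mem_classes k).1 φ h σ

theorem subst_mem_piClass (h : φ ∈ PiClass k) (σ : ℕ → Tm) : φ.subst σ ∈ PiClass k :=
  (subst_mem_classes k).2 φ h σ

/-- Replacing variables by components of a single variable keeps the prefix of the formula, so the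
result is an admissible instance of the scheme. -/
theorem stable_sigma_of_DNE {T : Set Fml} (H : ∀ φ ∈ HA, Proves T φ)
    (h : ProvesSchema T (DNE (SigmaClass k))) : ∀ φ ∈ SigmaClass k, Stable T φ :=
  fun φ hφ => stable_of_coded H rfl
    (h _ ⟨_, subst_mem_sigmaClass hφ _, FV_coded φ, rfl⟩)

theorem stable_or_of_DNEOr {T : Set Fml} (H : ∀ φ ∈ HA, Proves T φ)
    (h : ProvesSchema T (DNEOr (PiClass k) (PiClass k))) :
    ∀ φ ∈ PiClass k, ∀ ψ ∈ PiClass k, Stable T (Fml.or φ ψ) :=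
  fun φ hφ ψ hψ => stable_of_coded H rfl
    (h _ ⟨_, subst_mem_piClass hφ _, _, subst_mem_piClass hψ _, FV_coded φ, FV_coded ψ, rfl⟩)

end Classes

/-! ### Formulas with a prenex normal form -/

/-- `φ` is equivalent in `T` to a `Σ_k` formula with the same free variables. -/
def InSigma (T : Set Fml) (k : ℕ) (φ : Fml) : Prop := ∃ φ' ∈ SigmaClass k, Eqv T φ φ'

/-- `φ` is equivalent in `T` to a `Π_k` formula with the same free variables. -/
def InPi (T : Set Fml) (k : ℕ) (φ : Fml) : Prop := ∃ φ' ∈ PiClass k, Eqv T φ φ'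

section Prenex

open Derives

variable {T : Set Fml} {k j : ℕ} {φ ψ : Fml}

theorem InSigma.of_mem (h : φ ∈ SigmaClass k) : InSigma T k φ := ⟨φ, h, Eqv.refl φ⟩

theorem InPi.of_mem (h : φ ∈ PiClass k) : InPi T k φ := ⟨φ, h, Eqv.refl φ⟩

theorem InSigma.of_eqv (h : InSigma T k ψ) (e : Eqv T φ ψ) : InSigma T k φ :=
  let ⟨φ', h, e'⟩ := h
  ⟨φ', h, e.trans e'⟩

theorem InPi.of_eqv (h : InPi T k ψ) (e : Eqv T φ ψ) : InPi T k φ :=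
  let ⟨φ', h, e'⟩ := h
  ⟨φ', h, e.trans e'⟩

theorem InSigma.ex (h : InSigma T (k + 1) φ) : InSigma T (k + 1) (Fml.ex φ) :=
  let ⟨_, h, e⟩ := h
  ⟨_, ex_mem_sigmaClass h, e.ex⟩

theorem InPi.ex (h : InPi T k φ) : InSigma T (k + 1) (Fml.ex φ) :=
  let ⟨_, h, e⟩ := h
  ⟨_, ex_mem_sigmaClass_of_pi h, e.ex⟩

theorem InPi.all (h : InPi T (k + 1) φ) : InPi T (k + 1) (Fml.all φ) :=
  let ⟨_, h, e⟩ := h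
  ⟨_, all_mem_piClass h, e.all⟩

theorem InSigma.all (h : InSigma T k φ) : InPi T (k + 1) (Fml.all φ) :=
  let ⟨_, h, e⟩ := h
  ⟨_, all_mem_piClass_of_sigma h, e.all⟩

theorem InPi.toSigma (h : InPi T k φ) : InSigma T (k + 1) φ :=
  let ⟨_, h, e⟩ := h
  (InPi.of_mem (subst_mem_piClass h _)).ex.of_eqv (e.trans (Eqv.ex_shift _))

theorem InSigma.toPi (h : InSigma T k φ) : InPi T (k + 1) φ :=
  let ⟨_, h, e⟩ := h
  (InSigma.of_mem (subst_mem_sigmaClass h _)).all.of_eqv (e.trans (Eqv.all_shift _))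

/-- Blocks must be non-empty, so the classes are cumulative only up to equivalence; vacuous
quantifiers, which leave the free variables unchanged, fill the missing block. -/
theorem mem_classes_succ (k : ℕ) : (∀ φ ∈ SigmaClass k, InSigma T (k + 1) φ) ∧
    ∀ φ ∈ PiClass k, InPi T (k + 1) φ := by
  induction k with
  | zero =>
    constructor
    · intro φ hφ
      have : φ ∈ PiClass 0 := by rw [SigmaClass] at hφ; rwa [PiClass]
      exact (InPi.of_mem this).toSigma
    · intro φ hφ
      have : φ ∈ SigmaClass 0 := by rw [PiClass] at hφ; rwa [SigmaClass]
      exact (InSigma.of_mem this).toPi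
  | succ k ih =>
    exact ⟨sigmaClass_induction (fun ψ hψ => (ih.2 ψ hψ).toSigma) fun ψ _ _ h => h.ex,
      piClass_induction (fun ψ hψ => (ih.1 ψ hψ).toPi) fun ψ _ _ h => h.all⟩

theorem InSigma.succ (h : InSigma T k φ) : InSigma T (k + 1) φ :=
  let ⟨φ', h, e⟩ := h
  ((mem_classes_succ k).1 φ' h).of_eqv e

theorem InPi.succ (h : InPi T k φ) : InPi T (k + 1) φ :=
  let ⟨φ', h, e⟩ := h
  ((mem_classes_succ k).2 φ' h).of_eqv e

theorem InSigma.of_QF (h : φ.QF) (k : ℕ) : InSigma T k φ := by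
  induction k with
  | zero => exact InSigma.of_mem (by rw [SigmaClass]; exact h)
  | succ k ih => exact ih.succ

theorem InPi.of_QF (h : φ.QF) (k : ℕ) : InPi T k φ := by
  induction k with
  | zero => exact InPi.of_mem (by rw [PiClass]; exact h)
  | succ k ih => exact ih.succ

/-! ### Stability and negation -/

theorem InSigma.stable (hS : ∀ φ ∈ SigmaClass k, Stable T φ) (h : InSigma T k φ) : Stable T φ :=
  let ⟨φ', h, e⟩ := h
  e.stable (hS φ' h)

theorem stable_sigma_of_succ (hS : ∀ φ ∈ SigmaClass (k + 1), Stable T φ) :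
    ∀ φ ∈ SigmaClass k, Stable T φ :=
  fun _ h => (InSigma.of_mem h).succ.stable hS

/-- Stability passes through `∀`, so stability of the `Σ` matrix, one level down, is enough. -/
theorem stable_pi_of_sigma (hS : ∀ φ ∈ SigmaClass k, Stable T φ) :
    ∀ φ ∈ PiClass k, Stable T φ := by
  cases k with
  | zero =>
    intro φ hφ
    rw [PiClass] at hφ
    exact hS φ (by rwa [SigmaClass])
  | succ k => exact piClass_induction (stable_sigma_of_succ hS) fun ψ _ _ h => h.all

theorem InPi.stable (hS : ∀ φ ∈ SigmaClass k, Stable T φ) (h : InPi T k φ) : Stable T φ :=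
  let ⟨φ', h, e⟩ := h
  e.stable (stable_pi_of_sigma hS φ' h)

/-- If no `x` satisfied `¬φ`, stability of `φ` would give `∀xφ`. Hence `¬∀xφ` refutes `¬∃x¬φ`, and
stability of `∃x¬φ` finishes. -/
theorem Eqv.not_all (h₁ : Stable T φ) (h₂ : Stable T (Fml.ex (Fml.neg φ))) :
    Eqv T (Fml.neg (Fml.all φ)) (Fml.ex (Fml.neg φ)) where
  fv := by ext; simp [Fml.FV]
  mp _ h := h₂ _ (imp_intro fun _ hΔ h' => impE (h.mono hΔ) (all_intro fun t =>
    h₁.subst _ _ (imp_intro fun _ hΔ h'' => impE (h'.mono hΔ) (exI t h''))))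
  mpr _ h := ex_elim h fun _ t _ h => imp_intro fun _ hΔ h' => impE (h.mono hΔ) (allE t h')

theorem neg_mem_classes (k : ℕ) (hS : ∀ φ ∈ SigmaClass k, Stable T φ) :
    (∀ φ ∈ SigmaClass k, InPi T k (Fml.neg φ)) ∧ ∀ φ ∈ PiClass k, InSigma T k (Fml.neg φ) := by
  induction k with
  | zero =>
    simp only [SigmaClass, PiClass]
    exact ⟨fun φ h => InPi.of_QF (by exact ⟨h, trivial⟩) 0, fun φ h => InSigma.of_QF (by exact ⟨h, trivial⟩) 0⟩
  | succ k ih =>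
    have ih := ih (stable_sigma_of_succ hS)
    constructor
    · exact sigmaClass_induction (fun ψ hψ => (ih.2 ψ hψ).toPi)
        fun ψ _ _ h => h.all.of_eqv (Eqv.not_ex ψ)
    · refine piClass_induction (fun ψ hψ => (ih.1 ψ hψ).toSigma) fun ψ _ hψ h => ?_
      refine h.ex.of_eqv (Eqv.not_all ?_ (h.ex.stable hS))
      exact hψ.elim (stable_sigma_of_succ hS ψ) (stable_pi_of_sigma hS ψ)

theorem InPi.neg (hS : ∀ φ ∈ SigmaClass k, Stable T φ) (h : InPi T k φ) :
    InSigma T k (Fml.neg φ) :=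
  let ⟨φ', h, e⟩ := h
  ((neg_mem_classes k hS).2 φ' h).of_eqv e.neg

/-! ### Conjunction -/

theorem and_mem_classes (k : ℕ) :
    (∀ φ ∈ SigmaClass k, ∀ ψ ∈ SigmaClass k, InSigma T k (Fml.and φ ψ)) ∧
      ∀ φ ∈ PiClass k, ∀ ψ ∈ PiClass k, InPi T k (Fml.and φ ψ) := by
  induction k with
  | zero =>
    simp only [SigmaClass, PiClass]
    exact ⟨fun φ h ψ h' => InSigma.of_QF (by exact ⟨h, h'⟩) 0, fun φ h ψ h' => InPi.of_QF (by exact ⟨h, h'⟩) 0⟩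
  | succ k ih =>
    constructor
    · refine sigmaClass_induction (fun φ hφ ψ hψ => ?_) fun φ _ _ h ψ hψ =>
        (h _ (subst_mem_sigmaClass hψ _)).ex.of_eqv (Eqv.ex_and φ ψ)
      -- The first formula has lost its existential block and is in `Π_k`. It is generalized again
      -- because stripping the block of `ψ` shifts its variables.
      revert φ
      refine sigmaClass_induction (fun ψ hψ φ hφ => (ih.2 φ hφ ψ hψ).toSigma)
        (fun ψ _ _ h φ hφ => ?_) ψ hψ
      exact (h _ (subst_mem_piClass hφ _)).ex.of_eqv (Eqv.and_ex φ ψ)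
    · refine piClass_induction (fun φ hφ ψ hψ => ?_) fun φ _ _ h ψ hψ =>
        (h _ (subst_mem_piClass hψ _)).all.of_eqv (Eqv.all_and φ ψ)
      revert φ
      refine piClass_induction (fun ψ hψ φ hφ => (ih.1 φ hφ ψ hψ).toPi)
        (fun ψ _ _ h φ hφ => ?_) ψ hψ
      exact (h _ (subst_mem_sigmaClass hφ _)).all.of_eqv (Eqv.and_all φ ψ)

theorem InSigma.and (h₁ : InSigma T k φ) (h₂ : InSigma T k ψ) : InSigma T k (Fml.and φ ψ) :=
  let ⟨φ', h₁, e₁⟩ := h₁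
  let ⟨ψ', h₂, e₂⟩ := h₂
  ((and_mem_classes k).1 φ' h₁ ψ' h₂).of_eqv (e₁.and e₂)

theorem InPi.and (h₁ : InPi T k φ) (h₂ : InPi T k ψ) : InPi T k (Fml.and φ ψ) :=
  let ⟨φ', h₁, e₁⟩ := h₁
  let ⟨ψ', h₂, e₂⟩ := h₂
  ((and_mem_classes k).2 φ' h₁ ψ' h₂).of_eqv (e₁.and e₂)

/-! ### Disjunction and implication -/

/-- The principles `Σ_k-DNE` and `(Π_k ∨ Π_k)-DNE`, for formulas with any free variables. -/
structure StableClasses (T : Set Fml) (k : ℕ) : Prop where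
  sigma : ∀ φ ∈ SigmaClass k, Stable T φ
  or : ∀ φ ∈ PiClass k, ∀ ψ ∈ PiClass k, Stable T (Fml.or φ ψ)

theorem StableClasses.or_stable (h : StableClasses T k) (hφ : InPi T k φ) (hψ : InPi T k ψ) :
    Stable T (Fml.or φ ψ) :=
  let ⟨φ', hφ, e₁⟩ := hφ
  let ⟨ψ', hψ, e₂⟩ := hψ
  (e₁.or e₂).stable (h.or φ' hφ ψ' hψ)

theorem StableClasses.of_succ (h : StableClasses T (k + 1)) : StableClasses T k :=
  ⟨stable_sigma_of_succ h.sigma,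
    fun _ hφ _ hψ => h.or_stable (InPi.of_mem hφ).succ (InPi.of_mem hψ).succ⟩

theorem StableClasses.of_le (h : StableClasses T k) (hj : j ≤ k) : StableClasses T j := by
  induction k, hj using Nat.le_induction with
  | base => exact h
  | succ k _ ih => exact ih h.of_succ

/-- Only the direction from right to left is not intuitionistic. If `∀xφ ∨ ψ` fails, then `¬∀xφ`
gives some `t` with `¬φ(t)` by `Σ_{k+1}`-DNE; so `φ(t) ∨ ψ` yields `ψ`, a contradiction. The double
negation is removed by DNE for the disjunction of the two `Π_{k+1}` formulas `∀xφ` and `ψ`. -/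
theorem Eqv.all_or (h : StableClasses T (k + 1)) (hφ : InPi T (k + 1) φ) (hψ : InPi T (k + 1) ψ) :
    Eqv T (Fml.or (Fml.all φ) ψ) (Fml.all (Fml.or φ ψ.shift)) where
  fv := by ext; simp [Fml.FV]
  mp _ h' := all_intro fun t => by
    change Derives T _ (Fml.or (φ.inst t) (ψ.shift.inst t))
    rw [Fml.shift_inst]
    exact or_elim h' (fun _ _ h' => orI₁ (allE t h')) fun _ _ => orI₂
  mpr _ h' := by
    have hall (t : Tm) : Derives T _ (Fml.or (φ.inst t) (ψ.shift.inst t)) := allE t h'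
    simp only [Fml.shift_inst] at hall
    refine h.or_stable hφ.all hψ _ (imp_intro fun Δ hΔ hn => ?_)
    have hex : Derives T Δ (Fml.ex (Fml.neg φ)) :=
      (Eqv.not_all (hφ.stable h.sigma) ((hφ.neg h.sigma).ex.stable h.sigma)).mp _
        (imp_intro fun _ hΔ h' => impE (hn.mono hΔ) (orI₁ h'))
    exact ex_elim hex fun _ t hΔ' ht => or_elim (((hall t).mono hΔ).mono hΔ')
      (fun _ hΔ h' => impE (ht.mono hΔ) h')
      fun _ hΔ h' => impE ((hn.mono hΔ').mono hΔ) (orI₂ h')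

theorem Eqv.or_all (h : StableClasses T (k + 1)) (hφ : InPi T (k + 1) φ) (hψ : InPi T (k + 1) ψ) :
    Eqv T (Fml.or φ (Fml.all ψ)) (Fml.all (Fml.or φ.shift ψ)) :=
  (Eqv.or_comm _ _).trans ((Eqv.all_or h hψ hφ).trans (Eqv.or_comm _ _).all)

theorem or_mem_classes (k : ℕ) (hS : StableClasses T k) :
    (∀ φ ∈ SigmaClass k, ∀ ψ ∈ SigmaClass k, InSigma T k (Fml.or φ ψ)) ∧
      ∀ φ ∈ PiClass k, ∀ ψ ∈ PiClass k, InPi T k (Fml.or φ ψ) := by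
  induction k with
  | zero =>
    simp only [SigmaClass, PiClass]
    exact ⟨fun φ h ψ h' => InSigma.of_QF (by exact ⟨h, h'⟩) 0, fun φ h ψ h' => InPi.of_QF (by exact ⟨h, h'⟩) 0⟩
  | succ k ih =>
    have ih := ih hS.of_succ
    constructor
    · refine sigmaClass_induction (fun φ hφ ψ hψ => ?_) fun φ _ _ h ψ hψ =>
        (h _ (subst_mem_sigmaClass hψ _)).ex.of_eqv (Eqv.ex_or φ ψ)
      revert φ
      refine sigmaClass_induction (fun ψ hψ φ hφ => (ih.2 φ hφ ψ hψ).toSigma)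
        (fun ψ _ _ h φ hφ => ?_) ψ hψ
      exact (h _ (subst_mem_piClass hφ _)).ex.of_eqv (Eqv.or_ex φ ψ)
    · have hmem {φ : Fml} (h : φ ∈ SigmaClass k ∨ φ ∈ PiClass (k + 1)) : InPi T (k + 1) φ :=
        h.elim (fun h => (InSigma.of_mem h).toPi) InPi.of_mem
      refine piClass_induction (fun φ hφ ψ hψ => ?_) fun φ _ hφ h ψ hψ =>
        (h _ (subst_mem_piClass hψ _)).all.of_eqv (Eqv.all_or hS (hmem hφ) (InPi.of_mem hψ))
      revert φ
      refine piClass_induction (fun ψ hψ φ hφ => (ih.1 φ hφ ψ hψ).toPi)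
        (fun ψ _ hψ h φ hφ => ?_) ψ hψ
      exact (h _ (subst_mem_sigmaClass hφ _)).all.of_eqv
        (Eqv.or_all hS (hmem (Or.inl hφ)) (hmem hψ))

theorem InSigma.or (hS : StableClasses T k) (h₁ : InSigma T k φ) (h₂ : InSigma T k ψ) :
    InSigma T k (Fml.or φ ψ) :=
  let ⟨φ', h₁, e₁⟩ := h₁
  let ⟨ψ', h₂, e₂⟩ := h₂
  ((or_mem_classes k hS).1 φ' h₁ ψ' h₂).of_eqv (e₁.or e₂)

theorem InPi.or (hS : StableClasses T k) (h₁ : InPi T k φ) (h₂ : InPi T k ψ) :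
    InPi T k (Fml.or φ ψ) :=
  let ⟨φ', h₁, e₁⟩ := h₁
  let ⟨ψ', h₂, e₂⟩ := h₂
  ((or_mem_classes k hS).2 φ' h₁ ψ' h₂).of_eqv (e₁.or e₂)

theorem Eqv.imp_or (h : Stable T (Fml.or (Fml.neg φ) ψ)) :
    Eqv T (Fml.imp φ ψ) (Fml.or (Fml.neg φ) ψ) where
  fv := by ext; simp [Fml.FV]
  mp _ h' := h _ (imp_intro fun _ hΔ hn => impE hn (orI₁ (imp_intro fun _ hΔ' hφ =>
    impE (hn.mono hΔ') (orI₂ (impE ((h'.mono hΔ).mono hΔ') hφ)))))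
  mpr _ h' := imp_intro fun _ hΔ hφ => or_elim (h'.mono hΔ)
    (fun _ hΔ hn => falsumE (impE hn (hφ.mono hΔ))) fun _ _ h => h

/-- The disjunction `¬φ ∨ ψ` is itself `Σ_k` up to equivalence, hence stable, and stability is what
makes it follow from `φ → ψ`. -/
theorem InPi.imp (hS : StableClasses T k) (h₁ : InPi T k φ) (h₂ : InSigma T k ψ) :
    InSigma T k (Fml.imp φ ψ) :=
  have h := InSigma.or hS (h₁.neg hS.sigma) h₂
  h.of_eqv (Eqv.imp_or (h.stable hS.sigma))

/-- The `∃` of the antecedent and the `∀` of the consequent come out as `∀` intuitionistically. What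
remains is an implication from `Π_k` to `Σ_k`, which is `Σ_k` by the principles one level down. -/
theorem imp_mem_piClass (k : ℕ) (hS : StableClasses T k) :
    ∀ φ ∈ SigmaClass k, ∀ ψ ∈ PiClass k, InPi T k (Fml.imp φ ψ) := by
  cases k with
  | zero =>
    simp only [SigmaClass, PiClass]
    exact fun φ h ψ h' => InPi.of_QF (by exact ⟨h, h'⟩) 0
  | succ k =>
    refine sigmaClass_induction (fun φ hφ ψ hψ => ?_) fun φ _ _ h ψ hψ =>
      (h _ (subst_mem_piClass hψ _)).all.of_eqv (Eqv.ex_imp φ ψ)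
    revert φ
    refine piClass_induction (Q := fun ψ => ∀ φ ∈ PiClass k, InPi T (k + 1) (Fml.imp φ ψ))
      (fun ψ hψ φ hφ => (InPi.imp hS.of_succ (InPi.of_mem hφ) (InSigma.of_mem hψ)).toPi)
      (fun ψ _ _ h φ hφ => ?_) ψ hψ
    exact (h _ (subst_mem_piClass hφ _)).all.of_eqv (Eqv.imp_all φ ψ)

theorem InSigma.imp (hS : StableClasses T k) (h₁ : InSigma T k φ) (h₂ : InPi T k ψ) :
    InPi T k (Fml.imp φ ψ) :=
  let ⟨φ', h₁, e₁⟩ := h₁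
  let ⟨ψ', h₂, e₂⟩ := h₂
  (imp_mem_piClass k hS φ' h₁ ψ' h₂).of_eqv (e₁.imp e₂)

end Prenex

/-! ### Alternation paths -/

/-- The paths of `φ` have length at most `k`, and those of length `k > 0` begin with `b`. -/
def AltBound (b : Bool) (k : ℕ) (φ : Fml) : Prop :=
  ∀ s ∈ Alt φ, s.length ≤ k ∧ (s.length = k → k ≠ 0 → s.head? = some b)

section Alt

variable {b : Bool} {k : ℕ} {φ ψ : Fml}

theorem Alt_nonempty : ∀ φ : Fml, (Alt φ).Nonempty
  | .falsum => by simp [Alt]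
  | .eq _ _ => by simp [Alt]
  | .and φ _ => by simp [Alt, Alt_nonempty φ]
  | .or φ _ => by simp [Alt, Alt_nonempty φ]
  | .imp φ ψ => by cases ψ <;> simp [Alt, Alt_nonempty φ]
  | .all φ => by simp [Alt, Alt_nonempty φ]
  | .ex φ => by simp [Alt, Alt_nonempty φ]

theorem AltBound.mono {j : ℕ} (h : AltBound b k φ) (hj : k < j) (c : Bool) : AltBound c j φ :=
  fun s hs => ⟨((h s hs).1.trans_lt hj).le, fun e => by have := (h s hs).1; omega⟩

theorem AltBound.and (h : AltBound b k (Fml.and φ ψ)) : AltBound b k φ ∧ AltBound b k ψ :=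
  ⟨fun s hs => h s (Finset.mem_union_left _ hs), fun s hs => h s (Finset.mem_union_right _ hs)⟩

theorem AltBound.or (h : AltBound b k (Fml.or φ ψ)) : AltBound b k φ ∧ AltBound b k ψ :=
  ⟨fun s hs => h s (Finset.mem_union_left _ hs), fun s hs => h s (Finset.mem_union_right _ hs)⟩

theorem Alt_imp_subset (φ ψ : Fml) : (Alt φ).image perp ⊆ Alt (Fml.imp φ ψ) ∧
    (ψ = Fml.falsum ∨ Alt ψ ⊆ Alt (Fml.imp φ ψ)) := by
  cases ψ <;> simp [Alt]

theorem AltBound.imp (h : AltBound b k (Fml.imp φ ψ)) : AltBound (!b) k φ ∧ AltBound b k ψ := by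
  obtain ⟨h₁, h₂⟩ := Alt_imp_subset φ ψ
  constructor
  · intro s hs
    have h' := h (perp s) (h₁ (Finset.mem_image_of_mem _ hs))
    rw [perp, List.length_map, List.head?_map] at h'
    refine ⟨h'.1, fun e hk => ?_⟩
    have := h'.2 e hk
    rw [Option.map_eq_some_iff] at this
    obtain ⟨a, ha, hab⟩ := this
    rw [ha, ← hab]; simp
  · rcases h₂ with rfl | h₂
    -- The clause of `Alt` for negations omits the path of `⊥`, but that path is empty and satisfies
    -- every bound.
    · intro s hs
      simp only [Alt, Finset.mem_singleton] at hs
      subst hs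
      exact ⟨Nat.zero_le _, fun e hk => absurd e.symm hk⟩
    · exact fun s hs => h s (h₂ hs)

theorem extend_cases (c : Bool) (s : List Bool) :
    (extend c s = s ∧ s.head? = some c) ∨ (extend c s = c :: s ∧ s.head? ≠ some c) := by
  by_cases h : s.head? = some c
  · exact Or.inl ⟨if_pos h, h⟩
  · exact Or.inr ⟨if_neg h, h⟩

/-- A path that begins with `b` is kept by the quantifier; any other becomes longer, so it had
length less than `k`. -/
theorem altBound_of_image (h : ∀ s ∈ (Alt φ).image (extend b), s.length ≤ k ∧
    (s.length = k → k ≠ 0 → s.head? = some b)) : AltBound b k φ := by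
  intro s hs
  have h' := h _ (Finset.mem_image_of_mem _ hs)
  rcases extend_cases b s with ⟨e, _⟩ | ⟨e, _⟩ <;> rw [e] at h'
  · exact h'
  · have := h'.1
    rw [List.length_cons] at this
    exact ⟨by omega, fun e => by omega⟩

/-- Every path of the quantified formula begins with `b`, so the bound for the opposite sign
excludes length `k + 1`. Being non-empty, these paths also force `k ≠ 0`. -/
theorem altBound_of_image_not (h : ∀ s ∈ (Alt φ).image (extend b), s.length ≤ k + 1 ∧
    (s.length = k + 1 → k + 1 ≠ 0 → s.head? = some (!b))) : AltBound b k φ ∧ k ≠ 0 := by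
  have hhead : ∀ s, (extend b s).head? = some b := by
    intro s
    rcases extend_cases b s with ⟨e, h⟩ | ⟨e, _⟩ <;> rw [e]
    · exact h
    · rfl
  have hlen : ∀ s ∈ Alt φ, (extend b s).length ≤ k := by
    intro s hs
    have h' := h _ (Finset.mem_image_of_mem _ hs)
    rw [hhead] at h'
    refine Nat.le_of_lt_succ (lt_of_le_of_ne h'.1 fun e => ?_)
    simpa using h'.2 e (by omega)
  constructor
  · refine altBound_of_image fun s hs => ?_
    obtain ⟨u, hu, rfl⟩ := Finset.mem_image.1 hs
    exact ⟨hlen u hu, fun _ _ => hhead u⟩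
  · obtain ⟨s, hs⟩ := Alt_nonempty φ
    rintro rfl
    have h₁ := hhead s
    rw [List.eq_nil_of_length_eq_zero (Nat.le_zero.1 (hlen s hs))] at h₁
    simp at h₁

theorem QF_of_altBound : ∀ {φ : Fml} {b : Bool}, AltBound b 0 φ → φ.QF
  | .falsum, _, _ => trivial
  | .eq _ _, _, _ => trivial
  | .and _ _, _, h => ⟨QF_of_altBound h.and.1, QF_of_altBound h.and.2⟩
  | .or _ _, _, h => ⟨QF_of_altBound h.or.1, QF_of_altBound h.or.2⟩
  | .imp _ _, _, h => ⟨QF_of_altBound h.imp.1, QF_of_altBound h.imp.2⟩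
  -- A bound at `0` implies a bound at `1` for either sign. With the sign opposite to that of the
  -- quantifier, the level drops back to `0`, which is impossible for a quantified formula.
  | .all φ, _, h =>
    absurd rfl (altBound_of_image_not (b := false) (k := 0) (φ := φ)
      (h.mono Nat.zero_lt_one true)).2
  | .ex φ, _, h =>
    absurd rfl (altBound_of_image_not (b := true) (k := 0) (φ := φ)
      (h.mono Nat.zero_lt_one false)).2

theorem altBound_of_degree (hd : degree φ = k)
    (h : ∀ s ∈ Alt φ, s.length = k → k ≠ 0 → s.head? = some b) : AltBound b k φ :=
  fun s hs => ⟨hd ▸ Finset.le_sup (f := List.length) hs, h s hs⟩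

theorem altBound_of_mem_EClass (h : φ ∈ EClass k) : AltBound true k φ := by
  cases k with
  | zero => exact altBound_of_degree h fun _ _ _ h => absurd rfl h
  | succ k => exact altBound_of_degree h.1 fun s hs e _ => h.2 s hs e

theorem altBound_of_mem_UClass (h : φ ∈ UClass k) : AltBound false k φ := by
  cases k with
  | zero => exact altBound_of_degree h fun _ _ _ h => absurd rfl h
  | succ k => exact altBound_of_degree h.1 fun s hs e _ => h.2 s hs e

/-- The prenex normal form theorem for the cumulative classes. -/
theorem prenex_of_altBound {T : Set Fml} {K : ℕ} (hS : StableClasses T K) (φ : Fml) :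
    ∀ k ≤ K, (AltBound true k φ → InSigma T k φ) ∧ (AltBound false k φ → InPi T k φ) := by
  induction φ with
  | falsum => exact fun k _ => ⟨fun _ => InSigma.of_QF (by trivial) k, fun _ => InPi.of_QF (by trivial) k⟩
  | eq s t => exact fun k _ => ⟨fun _ => InSigma.of_QF (by trivial) k, fun _ => InPi.of_QF (by trivial) k⟩
  | and φ ψ h₁ h₂ =>
    exact fun k hk => ⟨fun h => ((h₁ k hk).1 h.and.1).and ((h₂ k hk).1 h.and.2),
      fun h => ((h₁ k hk).2 h.and.1).and ((h₂ k hk).2 h.and.2)⟩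
  | or φ ψ h₁ h₂ =>
    exact fun k hk => ⟨fun h => ((h₁ k hk).1 h.or.1).or (hS.of_le hk) ((h₂ k hk).1 h.or.2),
      fun h => ((h₁ k hk).2 h.or.1).or (hS.of_le hk) ((h₂ k hk).2 h.or.2)⟩
  | imp φ ψ h₁ h₂ =>
    exact fun k hk => ⟨fun h => ((h₁ k hk).2 h.imp.1).imp (hS.of_le hk) ((h₂ k hk).1 h.imp.2),
      fun h => ((h₁ k hk).1 h.imp.1).imp (hS.of_le hk) ((h₂ k hk).2 h.imp.2)⟩
  | all φ ih =>
    rintro (_ | k) hk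
    · exact ⟨fun h => (QF_of_altBound h).elim, fun h => (QF_of_altBound h).elim⟩
    · refine ⟨fun h => ?_, fun h => ((ih _ hk).2 (altBound_of_image h)).all⟩
      -- A universal formula within the bound for `Σ_{k+1}` already satisfies the bound for `Π_k`
      -- with `k > 0`. It is put in `Π_k` form and prefixed by a vacuous `∃`.
      obtain ⟨h, hk₀⟩ := altBound_of_image_not (b := false) h
      obtain ⟨k, rfl⟩ := Nat.exists_eq_succ_of_ne_zero hk₀
      exact ((ih _ (Nat.le_of_succ_le hk)).2 h).all.toSigma
  | ex φ ih =>
    rintro (_ | k) hk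
    · exact ⟨fun h => (QF_of_altBound h).elim, fun h => (QF_of_altBound h).elim⟩
    · refine ⟨fun h => ((ih _ hk).1 (altBound_of_image h)).ex, fun h => ?_⟩
      obtain ⟨h, hk₀⟩ := altBound_of_image_not (b := true) h
      obtain ⟨k, rfl⟩ := Nat.exists_eq_succ_of_ne_zero hk₀
      exact ((ih _ (Nat.le_of_succ_le hk)).1 h).ex.toPi

theorem PNFT_of_stableClasses {T : Set Fml} (hS : StableClasses T k) :
    PNFT T (EClass k) (SigmaClass k) ∧ PNFT T (UClass k) (PiClass k) := by
  constructor
  · intro φ hφ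
    obtain ⟨φ', h, e⟩ := (prenex_of_altBound hS φ k le_rfl).1 (altBound_of_mem_EClass hφ)
    exact ⟨φ', h, e.fv, e.proves⟩
  · intro φ hφ
    obtain ⟨φ', h, e⟩ := (prenex_of_altBound hS φ k le_rfl).2 (altBound_of_mem_UClass hφ)
    exact ⟨φ', h, e.fv, e.proves⟩

end Alt

/-! ### The negative translation relative to a formula -/

/-- The negative translation of a formula with `⊥` replaced by `A`. -/
def tr : Fml → Fml → Fml
  | .falsum, A => A
  | .eq s t, A => Fml.or (Fml.eq s t) A
  | .and φ ψ, A => Fml.and (tr φ A) (tr ψ A)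
  | .or φ ψ, A => Fml.imp (Fml.imp (Fml.or (tr φ A) (tr ψ A)) A) A
  | .imp φ ψ, A => Fml.imp (tr φ A) (tr ψ A)
  | .all φ, A => Fml.all (tr φ A.shift)
  | .ex φ, A => Fml.imp (Fml.imp (Fml.ex (tr φ A.shift)) A) A

theorem tr_subst (φ : Fml) : ∀ (A : Fml) (σ : ℕ → Tm),
    (tr φ A).subst σ = tr (φ.subst σ) (A.subst σ) := by
  induction φ with
  | falsum => intros; rfl
  | eq s t => intros; rfl
  | and φ ψ h₁ h₂ | or φ ψ h₁ h₂ | imp φ ψ h₁ h₂ => intros; simp only [tr, Fml.subst, h₁, h₂]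
  | all φ h | ex φ h => intros; simp only [tr, Fml.subst, h, Fml.shift_subst_up]

theorem tr_shift (φ A : Fml) : (tr φ A).shift = tr φ.shift A.shift := tr_subst _ _ _

theorem tr_inst (φ A : Fml) (t : Tm) : (tr φ A.shift).inst t = tr (φ.inst t) A := by
  rw [Fml.inst_eq, tr_subst, ← Fml.inst_eq, ← Fml.inst_eq, Fml.shift_inst]

theorem tr_stepSucc (φ A : Fml) : (tr φ A.shift).stepSucc = tr φ.stepSucc A.shift := by
  rw [Fml.stepSucc_eq, tr_subst, Fml.shift_subst_scons]; rfl

theorem tr_up_inst (φ A : Fml) (σ : ℕ → Tm) (t : Tm) :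
    (tr (φ.subst (Fml.up σ)) A.shift).inst t = tr (φ.subst (scons t σ)) A := by
  rw [tr_inst, Fml.subst_up_inst]

section Translation

open Derives

variable {T : Set Fml} {Γ : List Fml} {φ ψ χ A : Fml}

theorem tr_of_falsum (φ : Fml) : ∀ {A : Fml} {Γ : List Fml},
    Derives T Γ A → Derives T Γ (tr φ A) := by
  induction φ with
  | falsum => exact fun h => h
  | eq s t => exact fun h => orI₂ h
  | and φ ψ h₁ h₂ => exact fun h => andI (h₁ h) (h₂ h)
  | or φ ψ h₁ h₂ => exact fun h => imp_intro fun _ hΔ _ => h.mono hΔ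
  | imp φ ψ h₁ h₂ => exact fun h => imp_intro fun _ hΔ _ => h₂ (h.mono hΔ)
  | all φ ih => exact fun h => allI (ih (h.subst _))
  | ex φ ih => exact fun h => imp_intro fun _ hΔ _ => h.mono hΔ

/-- The translation is stable with respect to negation relative to `A`: prime formulas because
equality is decidable, `∨` and `∃` because three relative negations reduce to one. The substitution
is general because the case of `∀` passes to instances. -/
theorem tr_stable (H : ∀ φ ∈ HA, Proves T φ) (φ : Fml) : ∀ (σ : ℕ → Tm) {A : Fml} {Γ : List Fml},
    Derives T Γ (Fml.imp (Fml.imp (tr (φ.subst σ) A) A) A) → Derives T Γ (tr (φ.subst σ) A) := by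
  have triple {X A : Fml} {Γ : List Fml}
      (h : Derives T Γ (Fml.imp (Fml.imp (Fml.imp (Fml.imp X A) A) A) A)) :
      Derives T Γ (Fml.imp (Fml.imp X A) A) := imp_intro fun _ hΔ h₁ =>
    impE (h.mono hΔ) (imp_intro fun _ hΔ h₂ => impE h₂ (h₁.mono hΔ))
  have weaken {X Y A : Fml} {Γ : List Fml} (h : Derives T Γ (Fml.imp (Fml.imp X A) A))
      (hXY : ∀ Δ, Γ ⊆ Δ → Derives T Δ X → Derives T Δ Y) :
      Derives T Γ (Fml.imp (Fml.imp Y A) A) := imp_intro fun _ hΔ h₁ =>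
    impE (h.mono hΔ) (imp_intro fun _ hΔ' h₂ =>
      impE (h₁.mono hΔ') (hXY _ (fun _ hx => hΔ' (hΔ hx)) h₂))
  induction φ with
  | falsum => exact fun σ A Γ h => impE h (imp_intro fun _ _ h => h)
  | eq s t =>
    intro σ A Γ h
    exact or_elim (eq_decidable H (s.subst σ) (t.subst σ)) (fun _ _ => orI₁) fun _ hΔ h' =>
      orI₂ (impE (h.mono hΔ) (imp_intro fun _ hΔ h => or_elim h
        (fun _ hΔ' h => falsumE (impE ((h'.mono hΔ).mono hΔ') h)) fun _ _ h => h))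
  | and φ ψ h₁ h₂ =>
    exact fun σ A Γ h => andI (h₁ σ (weaken h fun _ _ => andE₁)) (h₂ σ (weaken h fun _ _ => andE₂))
  | or φ ψ h₁ h₂ => exact fun σ A Γ h => triple h
  | imp φ ψ h₁ h₂ =>
    exact fun σ A Γ h => imp_intro fun _ hΔ h' => h₂ σ
      (weaken (h.mono hΔ) fun _ hΔ h'' => impE h'' (h'.mono hΔ))
  | all φ ih =>
    intro σ A Γ h
    refine all_intro fun t => ?_
    rw [tr_up_inst]
    refine ih _ (weaken h fun _ _ h' => ?_)
    rw [← tr_up_inst]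
    exact allE t h'
  | ex φ ih => exact fun σ A Γ h => triple h

theorem tr_elim (H : ∀ φ ∈ HA, Proves T φ) (h : Derives T Γ (Fml.imp (Fml.imp ψ A) A))
    (h' : Derives T Γ (Fml.imp ψ (tr φ A))) : Derives T Γ (tr φ A) := by
  have hs := tr_stable H φ Term.var (A := A) (Γ := Γ)
  rw [Fml.subst_var] at hs
  exact hs (imp_intro fun _ hΔ h₁ => impE (h.mono hΔ)
    (imp_intro fun _ hΔ' h₂ => impE (h₁.mono hΔ') (impE ((h'.mono hΔ).mono hΔ') h₂)))

theorem tr_intro (h : Derives T Γ ψ) : Derives T Γ (Fml.imp (Fml.imp ψ A) A) :=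
  imp_intro fun _ hΔ h' => impE h' (h.mono hΔ)

theorem tr_HA (H : ∀ φ ∈ HA, Proves T φ) (hφ : φ ∈ HA) (A : Fml) : Derives T Γ (tr φ A) := by
  cases hφ with
  | succ_ne_zero t =>
    exact imp_intro fun _ _ h => or_elim h (fun _ _ h => Derives.succ_ne_zero H h) fun _ _ h => h
  | succ_inj s t =>
    exact imp_intro fun _ _ h => or_elim h (fun _ _ h => orI₁ (Derives.succ_inj H h))
      fun _ _ => orI₂
  | proj i t => exact orI₁ (of_proves (H _ (HA.proj i t)))
  | comp f g t => exact orI₁ (of_proves (H _ (HA.comp f g t)))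
  | prec_zero f g t => exact orI₁ (of_proves (H _ (HA.prec_zero f g t)))
  | prec_succ f g s t => exact orI₁ (of_proves (H _ (HA.prec_succ f g s t)))
  | induction φ =>
    -- The translation commutes with instantiation and with the successor step, so the translated
    -- axiom is the induction axiom for the translated formula.
    have h := H _ (HA.induction (tr φ A.shift))
    rw [tr_inst, tr_stepSucc] at h
    exact of_proves h

/-- Classical arithmetic is interpreted by the negative translation relative to `A`. -/
theorem tr_sound (H : ∀ φ ∈ HA, Proves T φ) (h : Derives PA Γ φ) :
    ∀ A, Derives T (Γ.map fun γ => tr γ A) (tr φ A) := by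
  have hshift : ∀ (Γ : List Fml) (A : Fml), (Γ.map Fml.shift).map (fun γ => tr γ A.shift) =
      (Γ.map fun γ => tr γ A).map Fml.shift := by
    intro Γ A
    simp only [List.map_map]
    exact List.map_congr_left fun γ _ => (tr_shift γ A).symm
  induction h with
  | ax h =>
    intro A
    rcases h with h | ⟨φ, rfl⟩
    · exact tr_HA H h A
    -- Translated excluded middle is the doubly negated excluded middle for `tr φ A`, relative to
    -- `A`, which is intuitionistically provable.
    · exact imp_intro fun _ _ h => impE h (orI₂ (imp_intro fun _ hΔ h' =>
        impE (h.mono hΔ) (orI₁ h')))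
  | hyp h => exact fun A => hyp (List.mem_map_of_mem h)
  | falsumE _ ih => exact fun A => tr_of_falsum _ (ih A)
  | andI _ _ ih₁ ih₂ => exact fun A => andI (ih₁ A) (ih₂ A)
  | andE₁ _ ih => exact fun A => andE₁ (ih A)
  | andE₂ _ ih => exact fun A => andE₂ (ih A)
  | orI₁ _ ih => exact fun A => tr_intro (orI₁ (ih A))
  | orI₂ _ ih => exact fun A => tr_intro (orI₂ (ih A))
  | orE _ _ _ ih ih₁ ih₂ =>
    exact fun A => tr_elim H (ih A) (imp_intro fun _ hΔ h => or_elim h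
      (fun _ hΔ' h => impE (((impI (ih₁ A)).mono hΔ).mono hΔ') h)
      fun _ hΔ' h => impE (((impI (ih₂ A)).mono hΔ).mono hΔ') h)
  | impI _ ih => exact fun A => impI (ih A)
  | impE _ _ ih₁ ih₂ => exact fun A => impE (ih₁ A) (ih₂ A)
  | allI _ ih => exact fun A => allI (by simpa only [hshift] using ih A.shift)
  | allE t _ ih => exact fun A => by rw [← tr_inst]; exact allE t (ih A)
  | exI t _ ih => exact fun A => tr_intro (exI t (by rw [tr_inst]; exact ih A))
  | exE _ _ ih₁ ih₂ =>
    intro A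
    refine tr_elim H (ih₁ A) (impI (exE (hyp List.mem_cons_self) ?_))
    have h := ih₂ A.shift
    rw [List.map_cons, hshift, ← tr_shift] at h
    exact h.mono (List.cons_subset_cons _ (List.map_subset _ (List.subset_cons_self _ _)))
  | eqRefl t => exact fun A => orI₁ (eqRefl t)
  | eqSubst φ _ _ ih₁ ih₂ =>
    intro A
    refine or_elim (ih₁ A) (fun _ hΔ h => ?_) fun _ _ h => tr_of_falsum _ h
    rw [← tr_inst]
    exact eqSubst _ h (by rw [tr_inst]; exact (ih₂ A).mono hΔ)

/-- The translation of each substitution instance of `φ` is equivalent to `φ ∨ A`. -/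
def TrOr (T : Set Fml) (φ : Fml) : Prop := ∀ (σ : ℕ → Tm) (A : Fml) (Γ : List Fml),
  (Derives T Γ (tr (φ.subst σ) A) → Derives T Γ (Fml.or (φ.subst σ) A)) ∧
    (Derives T Γ (φ.subst σ) → Derives T Γ (tr (φ.subst σ) A))

/-- This undoes the relative double negation in the clauses for `∨` and `∃`: if `φ` fails, then `ψ`
implies `A`, and so `A` holds. -/
theorem Decides.or_of_tr (hφ : Decides T φ)
    (h' : ∀ Δ, Γ ⊆ Δ → Derives T Δ ψ → Derives T Δ (Fml.or φ A))
    (h : Derives T Γ (Fml.imp (Fml.imp ψ A) A)) : Derives T Γ (Fml.or φ A) :=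
  or_elim (hφ Γ) (fun _ _ => orI₁) fun _ hΔ hn => orI₂ (impE (h.mono hΔ)
    (imp_intro fun _ hΔ' h => or_elim (h' _ (fun _ hx => hΔ' (hΔ hx)) h)
      (fun _ hΔ h => falsumE (impE ((hn.mono hΔ').mono hΔ) h)) fun _ _ h => h))

theorem trOr_of_QF (H : ∀ φ ∈ HA, Proves T φ) (hφ : φ.QF) : TrOr T φ := by
  have key : ∀ (φ : Fml), φ.QF → ∀ (A : Fml) (Γ : List Fml),
      (Derives T Γ (tr φ A) → Derives T Γ (Fml.or φ A)) ∧
        (Derives T Γ φ → Derives T Γ (tr φ A)) := by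
    intro φ
    induction φ with
    | falsum => exact fun _ A Γ => ⟨orI₂, falsumE⟩
    | eq s t => exact fun _ A Γ => ⟨fun h => h, orI₁⟩
    | and φ ψ h₁ h₂ =>
      intro hφ A Γ
      refine ⟨fun h => ?_, fun h => andI ((h₁ hφ.1 A Γ).2 (andE₁ h)) ((h₂ hφ.2 A Γ).2 (andE₂ h))⟩
      refine or_elim ((h₁ hφ.1 A Γ).1 (andE₁ h)) (fun Δ hΔ h' => ?_) fun _ _ => orI₂
      exact or_elim ((h₂ hφ.2 A Δ).1 (andE₂ (h.mono hΔ)))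
        (fun _ hΔ h'' => orI₁ (andI (h'.mono hΔ) h'')) fun _ _ => orI₂
    | or φ ψ h₁ h₂ =>
      intro hφ A Γ
      refine ⟨Decides.or_of_tr (fun _ => decidable_of_QF H _ hφ) fun _ _ h => or_elim h
        (fun _ _ h => or_elim ((h₁ hφ.1 A _).1 h) (fun _ _ h => orI₁ (orI₁ h)) fun _ _ => orI₂)
        (fun _ _ h => or_elim ((h₂ hφ.2 A _).1 h) (fun _ _ h => orI₁ (orI₂ h)) fun _ _ => orI₂),
        fun h => tr_intro (or_elim h (fun _ _ h => orI₁ ((h₁ hφ.1 A _).2 h))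
          fun _ _ h => orI₂ ((h₂ hφ.2 A _).2 h))⟩
    | imp φ ψ h₁ h₂ =>
      intro hφ A Γ
      refine ⟨fun h => or_elim (decidable_of_QF H φ hφ.1) (fun Δ hΔ h' => ?_) fun _ _ h' =>
        orI₁ (imp_intro fun _ hΔ h => falsumE (impE (h'.mono hΔ) h)), fun h =>
        imp_intro fun Δ hΔ h' => or_elim ((h₁ hφ.1 A Δ).1 h') (fun _ hΔ' h' =>
          (h₂ hφ.2 A _).2 (impE ((h.mono hΔ).mono hΔ') h')) fun _ _ h => tr_of_falsum _ h⟩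
      exact or_elim ((h₂ hφ.2 A Δ).1 (impE (h.mono hΔ) ((h₁ hφ.1 A Δ).2 h')))
        (fun _ _ h => orI₁ (imp_intro fun _ hΔ _ => h.mono hΔ)) fun _ _ => orI₂
    | all φ ih => exact fun h => h.elim
    | ex φ ih => exact fun h => h.elim
  exact fun σ A Γ => key _ (hφ.subst σ) A Γ

theorem TrOr.ex (h : TrOr T φ) (hd : Decides T (Fml.ex φ)) : TrOr T (Fml.ex φ) := by
  intro σ A Γ
  constructor
  · refine Decides.or_of_tr (hd.subst σ) fun Δ _ h' => ex_elim h' fun Δ' t _ ht => ?_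
    rw [tr_up_inst] at ht
    refine or_elim ((h _ A Δ').1 ht) (fun _ _ h => orI₁ (exI t ?_)) fun _ _ => orI₂
    rwa [Fml.subst_up_inst]
  · intro h'
    refine tr_intro (ex_elim h' fun Δ t _ ht => exI t ?_)
    rw [Fml.subst_up_inst] at ht
    rw [tr_up_inst]
    exact (h _ A Δ).2 ht

/-- Decide whether there is a counterexample. If `φ(t)` fails, the translation of `φ(t)`, being
`φ(t) ∨ A`, leaves `A`; if there is none, stability gives `∀xφ`. -/
theorem TrOr.all (h : TrOr T φ) (hd : Decides T (Fml.ex (Fml.neg φ))) (hs : Stable T φ) :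
    TrOr T (Fml.all φ) := by
  intro σ A Γ
  constructor
  · intro h'
    refine or_elim (hd.subst σ Γ) (fun Δ hΔ hex => ex_elim hex fun Δ' t hΔ' ht => orI₂ ?_)
      fun Δ hΔ hn => orI₁ (all_intro fun t => ?_)
    · have h₁ := (allE t h').mono fun _ hx => hΔ' (hΔ hx)
      rw [tr_up_inst] at h₁
      refine or_elim ((h _ A Δ').1 h₁) (fun _ hΔ h => falsumE (impE (ht.mono hΔ) ?_)) fun _ _ h => h
      rwa [← Fml.inst, Fml.subst_up_inst]
    · rw [Fml.subst_up_inst]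
      refine hs.subst _ _ (imp_intro fun _ hΔ h => impE (hn.mono hΔ) (exI t ?_))
      rw [Fml.subst_up_inst]
      exact h
  · intro h'
    refine all_intro fun t => ?_
    rw [tr_up_inst]
    refine (h _ A Γ).2 ?_
    rw [← Fml.subst_up_inst]
    exact allE t h'

theorem trOr_of_mem_classes (H : ∀ φ ∈ HA, Proves T φ) (j : ℕ)
    (hd : ∀ φ ∈ SigmaClass j, Decides T φ) :
    (∀ φ ∈ SigmaClass j, TrOr T φ) ∧ ∀ φ ∈ PiClass j, TrOr T φ := by
  have decides {k : ℕ} (hd : ∀ φ ∈ SigmaClass k, Decides T φ) {φ : Fml} (h : InSigma T k φ) :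
      Decides T φ := let ⟨φ', h, e⟩ := h; e.decides (hd φ' h)
  induction j with
  | zero =>
    simp only [SigmaClass, PiClass]
    exact ⟨fun φ h => trOr_of_QF H h, fun φ h => trOr_of_QF H h⟩
  | succ j ih =>
    have ih := ih fun φ h => decides hd (InSigma.of_mem h).succ
    have hS : ∀ φ ∈ SigmaClass (j + 1), Stable T φ := fun φ h => (hd φ h).stable
    constructor
    · exact sigmaClass_induction ih.2 fun ψ hψ _ h => h.ex (hd _ hψ)
    · refine piClass_induction ih.1 fun ψ _ hψ h => ?_
      have hψ : InPi T (j + 1) ψ := hψ.elim (fun h => (InSigma.of_mem h).toPi) InPi.of_mem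
      exact h.all (decides hd (hψ.neg hS).ex) (hψ.stable hS)

/-- One more block of `∃` than can be decided is admissible, because only the elimination of `A`
from `tr φ A` and `φ → A` is claimed, not `φ ∨ A`. The relative double negation in front of `∃` is
discharged by the conclusion `A` itself. -/
theorem tr_of_mem_sigmaClass (H : ∀ φ ∈ HA, Proves T φ) {j : ℕ}
    (hd : ∀ φ ∈ SigmaClass j, Decides T φ) : ∀ φ ∈ SigmaClass (j + 1),
    ∀ (σ : ℕ → Tm) (A : Fml) (Γ : List Fml),
      (Derives T Γ (φ.subst σ) → Derives T Γ (tr (φ.subst σ) A)) ∧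
        (Derives T Γ (tr (φ.subst σ) A) → Derives T Γ (Fml.imp (φ.subst σ) A) →
          Derives T Γ A) := by
  refine sigmaClass_induction (fun φ hφ σ A Γ => ?_) fun φ _ _ ih σ A Γ => ⟨fun h => ?_, fun h h' =>
    impE h (imp_intro fun Δ hΔ h => ex_elim h fun Δ' t hΔ' ht => ?_)⟩
  · have h := (trOr_of_mem_classes H j hd).2 φ hφ σ A Γ
    exact ⟨h.2, fun h₁ h₂ => or_elim (h.1 h₁) (fun _ hΔ h => impE (h₂.mono hΔ) h) fun _ _ h => h⟩
  · refine tr_intro (ex_elim h fun Δ t _ ht => exI t ?_)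
    rw [Fml.subst_up_inst] at ht
    rw [tr_up_inst]
    exact (ih _ A Δ).1 ht
  · rw [tr_up_inst] at ht
    refine (ih _ A Δ').2 ht (imp_intro fun _ hΔ'' h => ?_)
    refine impE (h'.mono fun _ hx => hΔ'' (hΔ' (hΔ hx))) (exI t ?_)
    rwa [Fml.subst_up_inst]

/-- Conservativity of classical arithmetic for implications between `Σ_{j + 1}` formulas. -/
theorem proves_imp_of_PA (H : ∀ φ ∈ HA, Proves T φ) {j : ℕ}
    (hd : ∀ φ ∈ SigmaClass j, Decides T φ) (hφ : φ ∈ SigmaClass (j + 1))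
    (hψ : ψ ∈ SigmaClass (j + 1)) (h : Proves PA (Fml.imp φ ψ)) : Proves T (Fml.imp φ ψ) := by
  have h₁ := tr_of_mem_sigmaClass H hd φ hφ Term.var ψ
  have h₂ := tr_of_mem_sigmaClass H hd ψ hψ Term.var ψ
  simp only [Fml.subst_var] at h₁ h₂
  -- The translation is taken relative to the conclusion `ψ`, so that the required implication from
  -- `ψ` to `A` is trivial.
  exact imp_intro fun Δ _ hφ => (h₂ Δ).2 (impE (of_proves (tr_sound H h ψ)) ((h₁ Δ).1 hφ))
    (imp_intro fun _ _ h => h)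

/-- Conservativity of classical arithmetic for `Σ_{j + 1}` formulas. -/
theorem proves_of_PA (H : ∀ φ ∈ HA, Proves T φ) {j : ℕ}
    (hd : ∀ φ ∈ SigmaClass j, Decides T φ) (hφ : φ ∈ SigmaClass (j + 1))
    (h : Proves PA φ) : Proves T φ := by
  have h₁ := tr_of_mem_sigmaClass H hd φ hφ Term.var φ []
  simp only [Fml.subst_var] at h₁
  exact h₁.2 (tr_sound H h φ) (imp_intro fun _ _ h => h)

end Translation

/-! ### Degrees of prenex formulas -/

/-- The alternating path of length `k` that begins with `b`. -/
def alternating : Bool → ℕ → List Bool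
  | _, 0 => []
  | b, k + 1 => b :: alternating (!b) k

theorem length_alternating (b : Bool) (k : ℕ) : (alternating b k).length = k := by
  induction k generalizing b with
  | zero => rfl
  | succ k ih => rw [alternating, List.length_cons, ih]

theorem perp_alternating (b : Bool) (k : ℕ) : perp (alternating b k) = alternating (!b) k := by
  induction k generalizing b with
  | zero => rfl
  | succ k ih =>
    have h := ih (!b)
    rw [perp] at h
    rw [alternating, perp, List.map_cons, h, alternating]

theorem extend_alternating_not (b : Bool) (k : ℕ) :
    extend b (alternating (!b) k) = alternating b (k + 1) := by
  cases k <;> simp [extend, alternating]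

theorem extend_alternating (b : Bool) (k : ℕ) :
    extend b (alternating b (k + 1)) = alternating b (k + 1) := by
  simp [extend, alternating]

theorem Alt_of_mem_classes (k : ℕ) : (∀ φ ∈ SigmaClass k, Alt φ = {alternating true k}) ∧
    ∀ φ ∈ PiClass k, Alt φ = {alternating false k} := by
  induction k with
  | zero =>
    simp only [SigmaClass, PiClass]
    exact ⟨fun φ h => Alt_of_QF φ h, fun φ h => Alt_of_QF φ h⟩
  | succ k ih =>
    simp only [SigmaClass, PiClass]
    constructor
    · rintro _ ⟨n, hn, ψ, hψ, rfl⟩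
      induction n, hn using Nat.le_induction with
      | base =>
        change (Alt ψ).image (extend true) = _
        rw [ih.2 ψ hψ, Finset.image_singleton, ← Bool.not_true, extend_alternating_not]
      | succ n _ ihn =>
        rw [Function.iterate_succ_apply', Alt, ihn, Finset.image_singleton, extend_alternating]
    · rintro _ ⟨n, hn, ψ, hψ, rfl⟩
      induction n, hn using Nat.le_induction with
      | base =>
        change (Alt ψ).image (extend false) = _
        rw [ih.1 ψ hψ, Finset.image_singleton, ← Bool.not_false, extend_alternating_not]
      | succ n _ ihn =>
        rw [Function.iterate_succ_apply', Alt, ihn, Finset.image_singleton, extend_alternating]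

-- From prenex normal forms to double negation elimination

section Converse

open Derives

variable {T : Set Fml} {k : ℕ} {φ ψ : Fml}

theorem mem_EClass_of_Alt (h : Alt φ = {alternating true k}) : φ ∈ EClass k := by
  have hd : degree φ = k := by rw [degree, h, Finset.sup_singleton, length_alternating]
  cases k with
  | zero => exact hd
  | succ k =>
    refine ⟨hd, fun s hs _ => ?_⟩
    rw [h, Finset.mem_singleton] at hs
    rw [hs]; rfl

theorem mem_UClass_of_Alt (h : Alt φ = {alternating false k}) : φ ∈ UClass k := by
  have hd : degree φ = k := by rw [degree, h, Finset.sup_singleton, length_alternating]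
  cases k with
  | zero => exact hd
  | succ k =>
    refine ⟨hd, fun s hs _ => ?_⟩
    rw [h, Finset.mem_singleton] at hs
    rw [hs]; rfl

theorem not_not_mem_EClass (h : φ ∈ SigmaClass k) : Fml.neg (Fml.neg φ) ∈ EClass k := by
  refine mem_EClass_of_Alt ?_
  change ((Alt φ).image perp).image perp = _
  rw [(Alt_of_mem_classes k).1 φ h]
  simp [perp_alternating]

theorem or_mem_UClass (h : φ ∈ PiClass k) (h' : ψ ∈ PiClass k) : Fml.or φ ψ ∈ UClass k := by
  refine mem_UClass_of_Alt ?_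
  rw [Alt, (Alt_of_mem_classes k).2 φ h, (Alt_of_mem_classes k).2 ψ h', Finset.union_self]

/-- The disjunction has paths of length `k + 1` with both first signs. The prefixed `-` lengthens
the path from `φ` to `k + 2` and is absorbed by the one from `¬φ`, so only paths beginning with `-`
are left. -/
theorem all_em_mem_UClass (h : φ ∈ SigmaClass (k + 1)) :
    Fml.all (Fml.or φ (Fml.neg φ)) ∈ UClass (k + 2) := by
  have hAlt : Alt (Fml.all (Fml.or φ (Fml.neg φ))) =
      {alternating false (k + 2), alternating false (k + 1)} := by
    change (Alt φ ∪ (Alt φ).image perp).image (extend false) = _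
    rw [(Alt_of_mem_classes (k + 1)).1 φ h]
    simp only [Finset.image_singleton, perp_alternating, Finset.image_union, Bool.not_true,
      extend_alternating]
    rw [← Bool.not_false, extend_alternating_not]; rfl
  refine ⟨?_, fun s hs _ => ?_⟩
  · change degree _ = _
    rw [degree, hAlt, Finset.sup_insert, Finset.sup_singleton, length_alternating,
      length_alternating]
    simp
  · rw [hAlt, Finset.mem_insert, Finset.mem_singleton] at hs
    rcases hs with rfl | rfl <;> rfl

theorem proves_of_all (h : Proves T (Fml.all φ)) : Proves T φ := by
  have h' := allE (Term.var 0) (proves_subst h fun n => Term.var (n + 1))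
  rw [Fml.subst_up_inst] at h'
  rwa [show scons (Term.var 0) (fun n => Term.var (n + 1)) = Term.var from
    funext fun n => by cases n <;> rfl, Fml.subst_var] at h'

/-- Conservativity of classical arithmetic for `Π_{j + 2}` formulas. -/
theorem proves_pi_of_PA (H : ∀ φ ∈ HA, Proves T φ) {j : ℕ}
    (hd : ∀ φ ∈ SigmaClass j, Decides T φ) :
    ∀ φ ∈ PiClass (j + 2), Proves PA φ → Proves T φ :=
  piClass_induction (fun _ hφ h => proves_of_PA H hd hφ h)
    fun _ _ _ ih h => allI (ih (proves_of_all h))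

/-- Excluded middle for `Σ_j` gives conservativity for `Π_{j+2}`, which is exactly the class of the
normal form of `∀x(φ ∨ ¬φ)` with `φ` in `Σ_{j+1}`. -/
theorem decides_sigma_of_PNFT (H : ∀ φ ∈ HA, Proves T φ) (hPA : IsSubtheory T PA) (j : ℕ)
    (h : ∀ i ≤ j + 1, PNFT T (UClass i) (PiClass i)) : ∀ φ ∈ SigmaClass j, Decides T φ := by
  induction j with
  | zero =>
    intro φ hφ
    rw [SigmaClass] at hφ
    exact fun _ => decidable_of_QF H φ hφ
  | succ j ih =>
    have ih := ih fun i hi => h i (by omega)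
    intro φ hφ
    obtain ⟨χ, hχ, _, hiff⟩ := h (j + 2) le_rfl _ (all_em_mem_UClass hφ)
    have hem : Proves PA (Fml.all (Fml.or φ (Fml.neg φ))) := allI (ax (Or.inr ⟨φ, rfl⟩))
    have hPAχ : Proves PA χ := impE (andE₁ (hPA _ hiff)) hem
    have hTχ := proves_pi_of_PA H ih χ hχ hPAχ
    exact fun _ => of_proves (proves_of_all (impE (andE₂ hiff) hTχ))

theorem stableClasses_of_PNFT (H : ∀ φ ∈ HA, Proves T φ) (hPA : IsSubtheory T PA)
    (h : ∀ i ≤ k, PNFT T (EClass i) (SigmaClass i) ∧ PNFT T (UClass i) (PiClass i)) :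
    StableClasses T k := by
  have hsigma : ∀ φ ∈ SigmaClass k, Stable T φ := by
    intro φ hφ
    cases k with
    | zero =>
      rw [SigmaClass] at hφ
      exact Decides.stable fun _ => decidable_of_QF H φ hφ
    | succ j =>
      obtain ⟨φ', hφ', _, hiff⟩ := (h _ le_rfl).1 _ (not_not_mem_EClass hφ)
      have hd := decides_sigma_of_PNFT H hPA j fun i hi => (h i hi).2
      -- In `PA`, the normal form `φ'` of `¬¬φ` implies `φ`. Both are `Σ_{j+1}`, and `Σ_j` is
      -- decidable in `T`, so the implication descends to `T`.
      have himp : Proves PA (Fml.imp φ' φ) := imp_intro fun Δ _ h₁ =>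
        Decides.stable (fun _ => ax (Or.inr ⟨φ, rfl⟩)) Δ
          (impE (of_proves (andE₂ (hPA _ hiff))) h₁)
      have himp := proves_imp_of_PA H hd hφ' hφ himp
      exact fun _ h => impE (of_proves himp) (impE (of_proves (andE₁ hiff)) h)
  refine ⟨hsigma, fun φ hφ ψ hψ => ?_⟩
  -- The disjunction inherits stability from its `Π_k` normal form.
  obtain ⟨χ, hχ, hFV, hiff⟩ := (h k le_rfl).2 _ (or_mem_UClass hφ hψ)
  exact (Eqv.of_proves hFV hiff).stable (stable_pi_of_sigma hsigma χ hχ)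

theorem StableClasses.proves_DNE (h : StableClasses T k) :
    ProvesSchema T (DNE (SigmaClass k)) := by
  rintro _ ⟨φ, hφ, _, rfl⟩
  exact allI (imp_intro fun _ _ h' => h.sigma φ hφ _ h')

theorem StableClasses.proves_DNEOr (h : StableClasses T k) :
    ProvesSchema T (DNEOr (PiClass k) (PiClass k)) := by
  rintro _ ⟨φ, hφ, ψ, hψ, _, _, rfl⟩
  exact allI (imp_intro fun _ _ h' => h.or φ hφ ψ hψ _ h')

end Converse

end SemiClassical

-- The characterization

theorem mainTheorem8 (T : Set SemiClassical.Fml)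
    (hHA : SemiClassical.IsSubtheory SemiClassical.HA T)
    (hPA : SemiClassical.IsSubtheory T SemiClassical.PA) (k : ℕ) :
    (SemiClassical.ProvesSchema T (SemiClassical.DNE (SemiClassical.SigmaClass k)) ∧
      SemiClassical.ProvesSchema T
        (SemiClassical.DNEOr (SemiClassical.PiClass k) (SemiClassical.PiClass k))) ↔
    ∀ k' ≤ k,
      SemiClassical.PNFT T (SemiClassical.EClass k') (SemiClassical.SigmaClass k') ∧
      SemiClassical.PNFT T (SemiClassical.UClass k') (SemiClassical.PiClass k') := by
  have H : ∀ φ ∈ SemiClassical.HA, SemiClassical.Proves T φ :=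
    fun φ hφ => hHA φ (SemiClassical.Derives.ax hφ)
  constructor
  · rintro ⟨h₁, h₂⟩ k' hk
    have hS : SemiClassical.StableClasses T k :=
      ⟨SemiClassical.stable_sigma_of_DNE H h₁, SemiClassical.stable_or_of_DNEOr H h₂⟩
    exact SemiClassical.PNFT_of_stableClasses (hS.of_le hk)
  · intro h
    have hS := SemiClassical.stableClasses_of_PNFT H hPA h
    exact ⟨hS.proves_DNE, hS.proves_DNEOr⟩
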